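/- Let $\mathbb T=\mathbb R/\mathbb Z$ be the circle, identified with $[0,1]$ with endpoints glued, and let $C(\mathbb T)$ be the space of continuous real- or complex-valued functions on $\mathbb T$ with the supremum norm. **Random homeomorphism.** Let $X_{n,k}$ ($n\ge 1$, $0<k<2^n$ odd) be independent random variables, each uniformly distributed on $[0,1]$. Define $\varphi$ on the dyadic rationals of $[0,1]$ by $\varphi(0)=0$, $\varphi(1)=1$ and, for odd $0<k<2^n$, $$\varphi(k2^{-n})=\varphi((k-1)2^{-n})+X_{n,k}\bigl(\varphi((k+1)2^{-n})-\varphi((k-1)2^{-n})\bigr).$$ **Interval properties.** An interval property is a map $T$ assigning to each $f\in C(\mathbb T)$ and each interval $I=[x,y]\subseteq[0,1]$ (with $x\le y$) a value $T(f;I)\in\{0,1\}$, such that 1. $(f,x,y)\mapsto T(f;[x,y])$ is Borel measurable on $\{(f,x,y)\in C(\mathbb T)\times[0,1]^2: x\le y\}$; 2. if $f|_I=g|_I$ almost everywhere, then $T(f;I)=T(g;I)$; 3. $T(f;[x,y])=T(f;[x,t])\,T(f;[t,y])$ whenever $x\le t\le y$, and $T(f;[x,x])=1$; 4. $T(f\circ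 L;L^{-1}(I))=T(f;I)$ for every non-constant affine map $L:\mathbb R\to\mathbb R$ with $L^{-1}(I)\subseteq[0,1]$; that is, $T(g;L^{-1}(I))=T(f;I)$ for every $g\in C(\mathbb T)$ that coincides with $f\circ L$ on $L^{-1}(I)$. Write $T(f)=T(f;[0,1])$. **Theorem (0-1 law).** With probability $1$, $\varphi$ extends to an increasing homeomorphism of $[0,1]$, again denoted $\varphi$. For every interval property $T$ and every $f\in C(\mathbb T)$, the event $\{T(f\circ\varphi)=1\}$ is measurable (with respect to the completed probability measure) and $$\mathbb P\bigl(T(f\circ\varphi)=1\bigr)\in\{0,1\}.$$ Moreover, let $p$ be any Lebesgue measurable function on $\{0\le x\le y\le 1\}$ with $0\le p\le 1$ that satisfies $$p(x,y)=\frac1{y-x}\int_x^y p(x,t)\,p(t,y)\,dt\qquad\text{for all }0\le x<y\le 1 .$$ Then for almost every triple $0\le x<y<z\le 1$, $$p(x,z)\le p(x,y),\qquad p(x,z)\le p(y,z),\qquad p(x,z)=p(x,y)\,p(y,z).$$ -/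

import Mathlib

open MeasureTheory ProbabilityTheory Set
open scoped unitInterval

noncomputable section

namespace RandomHomeo

/-- The composition `f ∘ φ` of a continuous function `f` on the circle `ℝ / ℤ` (that is, `[0,1]` with
its endpoints identified) with an increasing homeomorphism `φ` of `[0,1]`, as a function on the
circle. Increasing homeomorphisms of `[0,1]` are exactly its order automorphisms. -/
def circleComp {𝕜 : Type*} [RCLike 𝕜] (f : C(UnitAddCircle, 𝕜)) (φ : I ≃o I) :
    C(UnitAddCircle, 𝕜) where
  toFun := AddCircle.liftIco 1 0
    (fun t : ℝ => f (((φ (projIcc 0 1 zero_le_one t) : I) : ℝ) : UnitAddCircle))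
  continuous_toFun := by
    apply AddCircle.liftIco_continuous
    · have h0 : projIcc (0 : ℝ) 1 zero_le_one 0 = ⊥ := projIcc_left _
      have h1 : projIcc (0 : ℝ) 1 zero_le_one (0 + 1) = ⊤ := by
        rw [zero_add]; exact projIcc_right _
      have e0 : (((⊥ : I) : ℝ)) = 0 := rfl
      have e1 : (((⊤ : I) : ℝ)) = 1 := rfl
      rw [h0, h1, map_bot, map_top, e0, e1]
      congr 1
      simpa using (AddCircle.coe_period (1 : ℝ)).symm
    · refine Continuous.continuousOn ?_
      exact f.continuous.comp ((AddCircle.continuous_mk' 1).comp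
        (continuous_subtype_val.comp (φ.continuous.comp continuous_projIcc)))

theorem circleComp_apply {𝕜 : Type*} [RCLike 𝕜] (f : C(UnitAddCircle, 𝕜)) (φ : I ≃o I) (x : I) :
    circleComp f φ ((x : ℝ) : UnitAddCircle) = f (((φ x : I) : ℝ) : UnitAddCircle) := by
  have key : ∀ y : I, (y : ℝ) < 1 →
      circleComp f φ ((y : ℝ) : UnitAddCircle) = f (((φ y : I) : ℝ) : UnitAddCircle) := by
    intro y hy
    have h := AddCircle.liftIco_coe_apply (p := (1 : ℝ)) (a := 0)
      (f := fun t : ℝ => f (((φ (projIcc 0 1 zero_le_one t) : I) : ℝ) : UnitAddCircle))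
      (x := (y : ℝ)) ⟨y.2.1, by simpa using hy⟩
    simpa [circleComp] using h
  rcases lt_or_eq_of_le x.2.2 with h | h
  · exact key x h
  · have hx : x = ⊤ := Subtype.ext h
    have e0 : (((⊥ : I) : ℝ)) = 0 := rfl
    have e1 : (((⊤ : I) : ℝ)) = 1 := rfl
    have c : ((1 : ℝ) : UnitAddCircle) = ((0 : ℝ) : UnitAddCircle) := by
      simp
    have k := key ⊥ (by rw [e0]; exact one_pos)
    rw [map_bot, e0] at k
    rw [hx, map_top, e1, c, k]

/-- Interval properties: maps `T(f; [x,y]) ∈ {0,1}` of a continuous function `f` on the circle and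
an interval `[x,y] ⊆ [0,1]`. Only the values `T f x y` with `x ≤ y` have a meaning. -/
structure IsIntervalProperty {𝕜 : Type*} [RCLike 𝕜]
    (T : C(UnitAddCircle, 𝕜) → I → I → Fin 2) : Prop where
  /-- `T` is Borel measurable on `{(f, x, y) | x ≤ y}`. -/
  borel_measurable :
    MeasurableSet[borel (C(UnitAddCircle, 𝕜) × I × I)]
      {q : C(UnitAddCircle, 𝕜) × I × I | q.2.1 ≤ q.2.2 ∧ T q.1 q.2.1 q.2.2 = 1}
  /-- `T(f; [x,y])` depends only on the values of `f` almost everywhere on `[x,y]`. -/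
  congr_ae : ∀ (f g : C(UnitAddCircle, 𝕜)) (x y : I), x ≤ y →
    (∀ᵐ t : ℝ ∂(volume.restrict (Icc (x : ℝ) (y : ℝ))),
      f (t : UnitAddCircle) = g (t : UnitAddCircle)) → T f x y = T g x y
  mul : ∀ (f : C(UnitAddCircle, 𝕜)) (x t y : I), x ≤ t → t ≤ y → T f x y = T f x t * T f t y
  refl : ∀ (f : C(UnitAddCircle, 𝕜)) (x : I), T f x x = 1
  /-- `T(f ∘ L; L⁻¹ [a,b]) = T(f; [a,b])` for every non-constant affine map `L t = r t + s` with
  `L⁻¹ [a,b] = [c,d] ⊆ [0,1]`. As `T(· ; [c,d])` depends only on the restriction to `[c,d]`,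
  `f ∘ L` is represented by any continuous `g` on the circle that coincides with it on `[c,d]`. -/
  affine : ∀ (f g : C(UnitAddCircle, 𝕜)) (r s : ℝ) (a b c d : I), r ≠ 0 → a ≤ b → c ≤ d →
    (fun t : ℝ => r * t + s) ⁻¹' Icc (a : ℝ) (b : ℝ) = Icc (c : ℝ) (d : ℝ) →
    (∀ t ∈ Icc (c : ℝ) (d : ℝ), g (t : UnitAddCircle) = f ((r * t + s : ℝ) : UnitAddCircle)) →
    T g c d = T f a b

/-- `X n k`, for `n : ℕ` and odd `0 < k < 2 ^ n`, are independent random variables, each uniformly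
distributed on `[0,1]`. The other `X n k` are not used. -/
structure IsUniformFamily {Ω : Type*} [MeasurableSpace Ω] (P : Measure Ω)
    (X : ℕ → ℕ → Ω → ℝ) : Prop where
  measurable : ∀ n k : ℕ, Odd k → k < 2 ^ n → Measurable (X n k)
  uniform : ∀ n k : ℕ, Odd k → k < 2 ^ n → pdf.IsUniform (X n k) (Icc (0 : ℝ) 1) P volume
  indep : iIndepFun (fun i : {q : ℕ × ℕ // Odd q.2 ∧ q.2 < 2 ^ q.1} => X i.1.1 i.1.2) P

/-- `dyadicValue ξ n k` is the value `φ(k 2⁻ⁿ)`, `0 ≤ k ≤ 2ⁿ`, obtained from the numbers `ξ`: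
`φ(0) = 0`, `φ(1) = 1` and, for odd `k`,
`φ(k 2⁻ⁿ) = φ((k-1) 2⁻ⁿ) + ξ n k * (φ((k+1) 2⁻ⁿ) - φ((k-1) 2⁻ⁿ))`. -/
def dyadicValue (ξ : ℕ → ℕ → ℝ) : ℕ → ℕ → ℝ
  | 0, k => k
  | n + 1, k =>
    if Even k then dyadicValue ξ n (k / 2)
    else dyadicValue ξ n (k / 2) +
      ξ (n + 1) k * (dyadicValue ξ n (k / 2 + 1) - dyadicValue ξ n (k / 2))

/-- The increasing homeomorphism `φ` of `[0,1]` extends the function defined on the dyadic rationals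
by `ξ`. There is at most one such `φ`. -/
def Extends (ξ : ℕ → ℕ → ℝ) (φ : I ≃o I) : Prop :=
  ∀ (x : I) (n k : ℕ), (x : ℝ) = (k : ℝ) / 2 ^ n → ((φ x : I) : ℝ) = dyadicValue ξ n k

/-- The set of `ω` for which the random homeomorphism `φ` exists and `T(f ∘ φ; [0,1]) = 1`. -/
def propertyEvent {𝕜 : Type*} [RCLike 𝕜] {Ω : Type*} (X : ℕ → ℕ → Ω → ℝ)
    (T : C(UnitAddCircle, 𝕜) → I → I → Fin 2) (f : C(UnitAddCircle, 𝕜)) : Set Ω :=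
  {ω | ∃ φ : I ≃o I, Extends (fun n k => X n k ω) φ ∧ T (circleComp f φ) 0 1 = 1}

/-- The triangle `{0 ≤ x ≤ y ≤ 1}`. -/
def triangle : Set (ℝ × ℝ) := {q | 0 ≤ q.1 ∧ q.1 ≤ q.2 ∧ q.2 ≤ 1}

end RandomHomeo

end

namespace RandomHomeo

/-! ### Maximum principles for functions dominated by their own averages -/

section MaximumPrinciples

/-! Transplant `φ` to an interval `[x, y]` and let `p x y` be the probability that `T` holds on `[x,
y]` for `f` composed with this map. Once the first ratio is known, i.e. the image `t` of the
midpoint, the two halves are independent copies of the same construction on `[x, t]` and `[t, y]`;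
multiplicativity and affine invariance of `T` split the event accordingly
(`IsIntervalProperty.split`). Hence `p x y` is the mean of `p x t * p t y` over `t`
(`isSelfAveraging_prob`).

The analytic core is `IsSelfAveraging.ae_eq_mul`: any such `p` satisfies `p x z = p x y * p y z` for
almost every `y` and all `x < y < z`. Since `p ≤ 1`, the value `p x y` is at most the mean of `p x`
over `[x, y]`, so the means of `p x` over `[x, x + h]` increase, as `h` decreases to `0`, to a limit
`a x`. At Lebesgue points of `a` the averaging equation gives `a ≤ a * a`, so `a` is almost
everywhere `0` or `1`, and it agrees almost everywhere with the analogous limit from the left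
(`ae_rightLimit_eq`). The defect `E u v = |p (y - u) (y + v) - p (y - u) y * p y (y + v)|` is
subharmonic for the chain that shortens one of the two sides (`isSubharmonic_mulDefect`). For almost
every `y` its means over rectangles at the corner tend to `0`, because `p` is close on average to `a
y = a y * a y`. A bounded nonnegative subharmonic function with this property vanishes
(`IsSubharmonic.eq_zero`).

Applied to the probabilities, this says that the conditional probability of the event given the
first ratio is almost surely constant. By induction over generations the event is independent of
every finite set of ratios (`measure_eventOn_inter_pi`), hence of itself, so its probability is `0`
or `1`.

The homeomorphism exists because the expected sum of squared gaps of generation `n` is `(2 / 3) ^ n`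
(`lintegral_gapSum`), so almost surely the gaps shrink uniformly to `0`. -/

theorem intervalIntegrable_of_abs_le {F : ℝ → ℝ} {M : ℝ} (hF : Measurable F)
    (hM : ∀ t, |F t| ≤ M) (a b : ℝ) : IntervalIntegrable F volume a b := by
  refine (intervalIntegrable_const (c := M)).mono_fun hF.aestronglyMeasurable ?_
  refine Filter.Eventually.of_forall fun t => ?_
  simpa using (hM t).trans (le_abs_self M)

theorem intervalIntegral_swap_of_abs_le {E : ℝ → ℝ → ℝ} {M : ℝ}
    (hmeas : Measurable (Function.uncurry E)) (hM : ∀ u v, |E u v| ≤ M) (a b c d : ℝ) :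
    ∫ s in a..b, ∫ r in c..d, E s r = ∫ r in c..d, ∫ s in a..b, E s r := by
  have key : ∀ c d, c ≤ d →
      ∫ s in a..b, ∫ r in c..d, E s r = ∫ r in c..d, ∫ s in a..b, E s r := by
    intro c d hcd
    simp_rw [intervalIntegral.integral_of_le hcd]
    refine intervalIntegral_integral_swap ?_
    have : IsFiniteMeasure (volume.restrict (uIoc a b)) := by unfold uIoc; infer_instance
    have := (integrable_const M (μ := (volume.restrict (uIoc a b)).prod
      (volume.restrict (Ioc c d))))
    refine this.mono' hmeas.aestronglyMeasurable (Filter.Eventually.of_forall fun q => ?_)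
    exact hM q.1 q.2
  rcases le_total c d with h | h
  · exact key c d h
  · rw [intervalIntegral.integral_symm d c, ← key d c h, ← intervalIntegral.integral_neg]
    simp_rw [← intervalIntegral.integral_symm]

theorem intervalIntegral_le_mul {F : ℝ → ℝ} {a b C : ℝ} (hab : a ≤ b)
    (hF : IntervalIntegrable F volume a b) (hC : ∀ t ∈ Ioo a b, F t ≤ C) :
    ∫ t in a..b, F t ≤ (b - a) * C := by
  have h := intervalIntegral.integral_mono_on_of_le_Ioo hab hF
    (intervalIntegrable_const (c := C)) hC
  simpa using h

/-- An upper bound that can always be improved by the factor `q < 1` iterates to `M * q ^ n`. The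
maximum principles below reduce to this. -/
theorem forall_nonpos_of_contraction {α : Type*} {s : Set α} {F : α → ℝ} {M q : ℝ} (hM : 0 ≤ M)
    (hq0 : 0 ≤ q) (hq1 : q < 1) (hF : ∀ a ∈ s, F a ≤ M)
    (h : ∀ C, 0 ≤ C → (∀ a ∈ s, F a ≤ C) → ∀ a ∈ s, F a ≤ C * q) : ∀ a ∈ s, F a ≤ 0 := by
  have key : ∀ n : ℕ, ∀ a ∈ s, F a ≤ M * q ^ n := by
    intro n
    induction n with
    | zero => simpa using hF
    | succ n ih =>
      intro a ha
      rw [pow_succ, ← mul_assoc]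
      exact h _ (by positivity) ih a ha
  intro a ha
  have lim := (tendsto_pow_atTop_nhds_zero_of_lt_one hq0 hq1).const_mul M
  rw [mul_zero] at lim
  exact ge_of_tendsto' lim fun n => key n a ha

/-- A function dominated by its own integral mean, where the mean has a deficit of mass. -/
theorem nonpos_of_mul_le_integral {F : ℝ → ℝ} {x c H M : ℝ} (hx : x < c) (hM : 0 ≤ M)
    (hF : ∀ t ∈ Ioc c H, F t ≤ M) (hint : ∀ t, IntervalIntegrable F volume c t)
    (h : ∀ t ∈ Ioc c H, (t - x) * F t ≤ ∫ s in c..t, F s) : ∀ t ∈ Ioc c H, F t ≤ 0 := by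
  rcases le_or_gt H c with hH | hH
  · intro t ht
    exact absurd (ht.1.trans_le ht.2) (not_lt.2 hH)
  -- The integral has length `t - c` against the weight `t - x`; this ratio is largest at `t = H`.
  refine forall_nonpos_of_contraction (q := (H - c) / (H - x)) hM
    (div_nonneg (by linarith) (by linarith)) ((div_lt_one (by linarith)).2 (by linarith)) hF ?_
  intro C hC hFC t ht
  have h1 : ∫ s in c..t, F s ≤ (t - c) * C :=
    intervalIntegral_le_mul ht.1.le (hint t) fun s hs => hFC s ⟨hs.1, hs.2.le.trans ht.2⟩
  have h2 := (h t ht).trans h1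
  have htx : 0 < t - x := by linarith [ht.1]
  have h3 : F t ≤ C * ((t - c) / (t - x)) := by
    rw [← mul_div_assoc, le_div_iff₀ htx]
    linarith
  refine h3.trans (mul_le_mul_of_nonneg_left ?_ hC)
  rw [div_le_div_iff₀ htx (by linarith)]
  nlinarith [ht.1, ht.2]

/-- Subharmonicity on the open quadrant, for the chain that replaces one of the two coordinates by
a smaller one. -/
def IsSubharmonic (F : ℝ → ℝ → ℝ) : Prop :=
  ∀ u v : ℝ, 0 < u → 0 < v →
    (u + v) * F u v ≤ (∫ s in 0..u, F s v) + ∫ r in 0..v, F u r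

theorem IsSubharmonic.swap {F : ℝ → ℝ → ℝ} (hF : IsSubharmonic F) :
    IsSubharmonic fun u v => F v u := by
  intro u v hu hv
  have := hF v u hv hu
  linarith

/-- For `v ≥ δ` a share `δ / (u + v) ≥ δ / (U + H)` of the averaging mass lies in the strip where `F
≤ 0` is known, so any upper bound contracts by the factor `1 - δ / (U + H)`. -/
theorem IsSubharmonic.nonpos_of_strip {F : ℝ → ℝ → ℝ} {M U H δ : ℝ} (hF : IsSubharmonic F)
    (hmeas : Measurable (Function.uncurry F)) (hM : ∀ u v, |F u v| ≤ M)
    (hδ : 0 < δ) (hδU : δ ≤ U + H)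
    (h0 : ∀ u r, 0 < u → u < U → 0 < r → r < δ → F u r ≤ 0) :
    ∀ u v, 0 < u → u < U → 0 < v → v < H → F u v ≤ 0 := by
  have hUH : 0 < U + H := hδ.trans_le hδU
  have hM0 : 0 ≤ M := (abs_nonneg _).trans (hM 0 0)
  have i1 : ∀ v a b, IntervalIntegrable (fun s => F s v) volume a b := fun v =>
    intervalIntegrable_of_abs_le (hmeas.comp (measurable_id.prodMk measurable_const))
      fun s => hM s v
  have i2 : ∀ u a b, IntervalIntegrable (fun r => F u r) volume a b := fun u =>
    intervalIntegrable_of_abs_le (hmeas.comp (measurable_const.prodMk measurable_id))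
      fun s => hM u s
  have key := forall_nonpos_of_contraction (s := Ioo 0 U ×ˢ Ioo 0 H)
    (F := fun a : ℝ × ℝ => F a.1 a.2) (M := M) (q := 1 - δ / (U + H)) hM0
    (by rw [sub_nonneg]; exact (div_le_one hUH).2 hδU)
    (by linarith [div_pos hδ hUH]) (fun a _ => (le_abs_self _).trans (hM _ _)) ?_
  · exact fun u v hu hu' hv hv' => key (u, v) ⟨⟨hu, hu'⟩, hv, hv'⟩
  rintro C hC hFC ⟨u, v⟩ ⟨⟨hu, hu'⟩, hv, hv'⟩
  dsimp only at *
  have hq : 0 ≤ 1 - δ / (U + H) := by rw [sub_nonneg]; exact (div_le_one hUH).2 hδU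
  rcases lt_or_ge v δ with hvδ | hvδ
  · exact (h0 u v hu hu' hv hvδ).trans (mul_nonneg hC hq)
  have e1 : ∫ s in 0..u, F s v ≤ (u - 0) * C :=
    intervalIntegral_le_mul hu.le (i1 v 0 u) fun s hs =>
      hFC (s, v) ⟨⟨hs.1, hs.2.trans hu'⟩, hv, hv'⟩
  have e2 : ∫ r in 0..δ, F u r ≤ (δ - 0) * 0 :=
    intervalIntegral_le_mul hδ.le (i2 u 0 δ) fun r hr => h0 u r hu hu' hr.1 hr.2
  have e3 : ∫ r in δ..v, F u r ≤ (v - δ) * C :=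
    intervalIntegral_le_mul hvδ (i2 u δ v) fun r hr =>
      hFC (u, r) ⟨⟨hu, hu'⟩, hδ.trans hr.1, hr.2.trans hv'⟩
  have e4 := hF u v hu hv
  rw [← intervalIntegral.integral_add_adjacent_intervals (i2 u 0 δ) (i2 u δ v)] at e4
  have huv : 0 < u + v := by linarith
  have e5 : F u v ≤ C * ((u + v - δ) / (u + v)) := by
    rw [← mul_div_assoc, le_div_iff₀ huv]
    nlinarith
  refine e5.trans (mul_le_mul_of_nonneg_left ?_ hC)
  rw [sub_div, div_self huv.ne']
  gcongr

/-- If the rectangle means of `E` near the origin are at most `ε`, a bound `V` on `E` in a square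
improves to `V / 2 + ε`. -/
theorem IsSubharmonic.improve_of_le {E : ℝ → ℝ → ℝ} {V ε δ : ℝ} (hE : IsSubharmonic E)
    (hmeas : Measurable (Function.uncurry E)) (hE0 : ∀ u v, 0 ≤ E u v) (hE1 : ∀ u v, E u v ≤ 1)
    (hV : 0 ≤ V) (hε : 0 ≤ ε)
    (hrect : ∀ u v, 0 < u → u < δ → 0 < v → v < δ →
      ∫ s in 0..u, ∫ r in 0..v, E s r ≤ ε * u * v)
    (hrect' : ∀ u v, 0 < u → u < δ → 0 < v → v < δ →
      ∫ r in 0..v, ∫ s in 0..u, E s r ≤ ε * u * v)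
    (hEV : ∀ u v, 0 < u → u < δ → 0 < v → v < δ → E u v ≤ V) :
    ∀ u v, 0 < u → u ≤ v → v < δ → E u v ≤ V / 2 + ε := by
  have hM : ∀ u v, |E u v| ≤ 1 := fun u v => by rw [abs_of_nonneg (hE0 u v)]; exact hE1 u v
  have i1 : ∀ v a b, IntervalIntegrable (fun s => E s v) volume a b := fun v =>
    intervalIntegrable_of_abs_le (hmeas.comp (measurable_id.prodMk measurable_const))
      fun s => hM s v
  have i2 : ∀ u a b, IntervalIntegrable (fun r => E u r) volume a b := fun u =>
    intervalIntegrable_of_abs_le (hmeas.comp (measurable_const.prodMk measurable_id))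
      fun s => hM u s
  have i3 : ∀ v a b, 0 ≤ v → IntervalIntegrable (fun s => ∫ r in 0..v, E s r) volume a b := by
    intro v a b hv
    refine intervalIntegrable_of_abs_le (M := v) ?_ (fun s => ?_) a b
    · simp_rw [intervalIntegral.integral_of_le hv]
      exact (hmeas.stronglyMeasurable.integral_prod_right (ν := volume.restrict (Ioc 0 v))).measurable
    · rw [abs_of_nonneg (intervalIntegral.integral_nonneg hv fun r _ => hE0 s r)]
      simpa using intervalIntegral_le_mul hv (i2 s 0 v) fun r _ => hE1 s r
  have i4 : ∀ u a b, 0 ≤ u → IntervalIntegrable (fun r => ∫ s in 0..u, E s r) volume a b := by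
    intro u a b hu
    refine intervalIntegrable_of_abs_le (M := u) ?_ (fun r => ?_) a b
    · simp_rw [intervalIntegral.integral_of_le hu]
      exact (hmeas.stronglyMeasurable.integral_prod_left (μ := volume.restrict (Ioc 0 u))).measurable
    · rw [abs_of_nonneg (intervalIntegral.integral_nonneg hu fun s _ => hE0 s r)]
      simpa using intervalIntegral_le_mul hu (i1 r 0 u) fun s _ => hE1 s r
  -- At `(s, v)` with `s ≤ v`, at most half of the mass moves horizontally, where `E ≤ V`. The
  -- vertical part, integrated over `s`, becomes a rectangle mean.
  have k1 : ∀ u v, 0 < u → u ≤ v → v < δ → ∫ s in 0..u, E s v ≤ u * (V / 2 + ε) := by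
    intro u v hu huv hvδ
    have hv : 0 < v := hu.trans_le huv
    have b : ∀ s ∈ Ioo 0 u, E s v ≤ V / 2 + (∫ r in 0..v, E s r) / v := by
      intro s hs
      have h1 := hE s v hs.1 hv
      have h2 : ∫ w in 0..s, E w v ≤ (s - 0) * V := intervalIntegral_le_mul hs.1.le (i1 v 0 s)
        fun w hw => hEV w v hw.1 (by linarith [hw.2, hs.2]) hv hvδ
      have h3 : 0 ≤ ∫ r in 0..v, E s r :=
        intervalIntegral.integral_nonneg hv.le fun r _ => hE0 s r
      have hsv : 0 < s + v := by linarith [hs.1]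
      have h4 : E s v ≤ s * V / (s + v) + (∫ r in 0..v, E s r) / (s + v) := by
        rw [← add_div, le_div_iff₀ hsv]
        linarith
      have h5 : s * V / (s + v) ≤ V / 2 := by
        rw [div_le_div_iff₀ hsv two_pos]
        nlinarith [hs.2]
      have h6 : (∫ r in 0..v, E s r) / (s + v) ≤ (∫ r in 0..v, E s r) / v := by
        gcongr
        linarith [hs.1]
      linarith
    have h := intervalIntegral.integral_mono_on_of_le_Ioo hu.le (i1 v 0 u)
      ((intervalIntegrable_const (c := V / 2)).add ((i3 v 0 u hv.le).div_const v)) b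
    rw [intervalIntegral.integral_add intervalIntegrable_const ((i3 v 0 u hv.le).div_const v),
      intervalIntegral.integral_const, smul_eq_mul, intervalIntegral.integral_div] at h
    have h7 : (∫ s in 0..u, ∫ r in 0..v, E s r) / v ≤ ε * u := by
      rw [div_le_iff₀ hv]
      exact hrect u v hu (huv.trans_lt hvδ) hv hvδ
    linarith
  -- The same estimate with the axes exchanged, for the vertical segment that ends on the diagonal.
  have k2 : ∀ u, 0 < u → u < δ → ∫ r in 0..u, E u r ≤ u * (V / 2 + ε) := by
    intro u hu huδ
    have b : ∀ s ∈ Ioo 0 u, E u s ≤ V / 2 + (∫ r in 0..u, E r s) / u := by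
      intro s hs
      have h1 := hE u s hu hs.1
      have h2 : ∫ w in 0..s, E u w ≤ (s - 0) * V := intervalIntegral_le_mul hs.1.le (i2 u 0 s)
        fun w hw => hEV u w hu huδ hw.1 (by linarith [hw.2, hs.2])
      have h3 : 0 ≤ ∫ r in 0..u, E r s :=
        intervalIntegral.integral_nonneg hu.le fun r _ => hE0 r s
      have hsv : 0 < u + s := by linarith [hs.1]
      have h4 : E u s ≤ s * V / (u + s) + (∫ r in 0..u, E r s) / (u + s) := by
        rw [← add_div, le_div_iff₀ hsv]
        linarith
      have h5 : s * V / (u + s) ≤ V / 2 := by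
        rw [div_le_div_iff₀ hsv two_pos]
        nlinarith [hs.2]
      have h6 : (∫ r in 0..u, E r s) / (u + s) ≤ (∫ r in 0..u, E r s) / u := by
        gcongr
        linarith [hs.1]
      linarith
    have h := intervalIntegral.integral_mono_on_of_le_Ioo hu.le (i2 u 0 u)
      ((intervalIntegrable_const (c := V / 2)).add ((i4 u 0 u hu.le).div_const u)) b
    rw [intervalIntegral.integral_add intervalIntegrable_const ((i4 u 0 u hu.le).div_const u),
      intervalIntegral.integral_const, smul_eq_mul, intervalIntegral.integral_div] at h
    have h7 : (∫ s in 0..u, ∫ r in 0..u, E r s) / u ≤ ε * u := by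
      rw [div_le_iff₀ hu]
      exact hrect' u u hu huδ hu huδ
    linarith
  intro u v hu huv hvδ
  have huδ := huv.trans_lt hvδ
  rcases huv.eq_or_lt with rfl | huv'
  · have h1 := hE u u hu hu
    have h2 := k1 u u hu le_rfl huδ
    have h3 := k2 u hu huδ
    have h4 : u * (2 * E u u) ≤ u * (2 * (V / 2 + ε)) := by linarith
    linarith [le_of_mul_le_mul_left h4 hu]
  have i5 : ∀ a b, IntervalIntegrable (fun r => E u r - (V / 2 + ε)) volume a b := fun a b =>
    (i2 u a b).sub intervalIntegrable_const
  -- Above the diagonal, `k1` and `k2` control a mass `2 * u` out of `u + t`. What remains is a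
  -- one-variable mean over `[u, t]` with weight `t - (-u)`.
  have := nonpos_of_mul_le_integral (F := fun r => E u r - (V / 2 + ε)) (x := -u) (c := u) (H := v)
    (M := 1) (by linarith) zero_le_one (fun t _ => by linarith [hE1 u t]) (i5 u) ?_ v
    ⟨huv', le_rfl⟩
  · linarith
  intro t ht
  have ht0 : 0 < t := hu.trans ht.1
  have h1 := hE u t hu ht0
  have h2 := k1 u t hu ht.1.le (ht.2.trans_lt hvδ)
  have h3 := k2 u hu huδ
  rw [intervalIntegral.integral_sub (i2 u u t) intervalIntegrable_const,
    intervalIntegral.integral_const, smul_eq_mul]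
  have h4 := intervalIntegral.integral_add_adjacent_intervals (i2 u 0 u) (i2 u u t)
  linarith

/-- A bounded nonnegative subharmonic function on the quadrant whose rectangle means tend to zero at
the origin vanishes. -/
theorem IsSubharmonic.eq_zero {E : ℝ → ℝ → ℝ} (hE : IsSubharmonic E)
    (hmeas : Measurable (Function.uncurry E)) (hE0 : ∀ u v, 0 ≤ E u v) (hE1 : ∀ u v, E u v ≤ 1)
    (hrect : ∀ ε > 0, ∃ δ > 0, ∀ u v, 0 < u → u < δ → 0 < v → v < δ →
      ∫ s in 0..u, ∫ r in 0..v, E s r ≤ ε * u * v)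
    {u v : ℝ} (hu : 0 < u) (hv : 0 < v) : E u v = 0 := by
  refine le_antisymm (le_of_forall_pos_le_add fun ε' hε' => ?_) (hE0 u v)
  obtain ⟨ε, hε, rfl⟩ : ∃ ε, 0 < ε ∧ ε' = 2 * ε := ⟨ε' / 2, by linarith, by ring⟩
  obtain ⟨δ, hδ, h₁⟩ := hrect ε hε
  have h₂ : ∀ u v, 0 < u → u < δ → 0 < v → v < δ →
      ∫ r in 0..v, ∫ s in 0..u, E s r ≤ ε * u * v := by
    intro u v a b c d
    rw [← intervalIntegral_swap_of_abs_le hmeas (M := 1)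
      fun u v => abs_le.2 ⟨by linarith [hE0 u v], hE1 u v⟩]
    exact h₁ u v a b c d
  have hM : ∀ u v, |E u v - 2 * ε| ≤ 1 + 2 * ε := fun u v => by
    rw [abs_le]; constructor <;> linarith [hE0 u v, hE1 u v]
  have hmeas' : Measurable (Function.uncurry fun u v => E u v - 2 * ε) := hmeas.sub_const _
  have hmeas'' : Measurable (Function.uncurry fun u v => E v u) := hmeas.comp measurable_swap
  -- `2 * ε` is the fixed point of `V ↦ V / 2 + ε`, so the excess over it halves at each
  -- improvement.
  have near : ∀ u v, 0 < u → u < δ → 0 < v → v < δ → E u v - 2 * ε ≤ 0 := by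
    have := forall_nonpos_of_contraction (s := Ioo 0 δ ×ˢ Ioo 0 δ)
      (F := fun a : ℝ × ℝ => E a.1 a.2 - 2 * ε) (M := 1) (q := 1 / 2) zero_le_one (by norm_num)
      (by norm_num) (fun a _ => by linarith [hE1 a.1 a.2]) ?_
    · exact fun u v hu hu' hv hv' => this (u, v) ⟨⟨hu, hu'⟩, hv, hv'⟩
    rintro C hC hEC ⟨u, v⟩ ⟨⟨hu, hu'⟩, hv, hv'⟩
    have bd : ∀ u v, 0 < u → u < δ → 0 < v → v < δ → E u v ≤ C + 2 * ε :=
      fun u v hu hu' hv hv' => by linarith [hEC (u, v) ⟨⟨hu, hu'⟩, hv, hv'⟩]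
    rcases le_total u v with h | h
    · have := hE.improve_of_le hmeas hE0 hE1 (V := C + 2 * ε) (by linarith) hε.le
        h₁ h₂ bd u v hu h hv'
      dsimp only
      linarith
    · have := hE.swap.improve_of_le hmeas'' (fun u v => hE0 v u) (fun u v => hE1 v u)
        (V := C + 2 * ε) (by linarith) hε.le
        (fun u v a b c d => (h₂ v u c d a b).trans_eq (by ring))
        (fun u v a b c d => (h₁ v u c d a b).trans_eq (by ring))
        (fun u v a b c d => bd v u c d a b) v u hv h hu'
      dsimp only at this ⊢
      linarith
  have hsub : IsSubharmonic fun u v => E u v - 2 * ε := by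
    intro u v hu hv
    have i1 : IntervalIntegrable (fun s => E s v) volume 0 u :=
      intervalIntegrable_of_abs_le (F := fun s => E s v)
        (hmeas.comp (measurable_id.prodMk measurable_const)) (M := 1) (fun s => abs_le.2 ⟨by linarith [hE0 s v], hE1 s v⟩) _ _
    have i2 : IntervalIntegrable (fun r => E u r) volume 0 v :=
      intervalIntegrable_of_abs_le (F := fun r => E u r)
        (hmeas.comp (measurable_const.prodMk measurable_id)) (M := 1) (fun s => abs_le.2 ⟨by linarith [hE0 u s], hE1 u s⟩) _ _
    rw [intervalIntegral.integral_sub i1 intervalIntegrable_const,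
      intervalIntegral.integral_sub i2 intervalIntegrable_const]
    simp only [intervalIntegral.integral_const, smul_eq_mul]
    linarith [hE u v hu hv]
  obtain ⟨H, huH, hvH, hH⟩ : ∃ H, u < H ∧ v < H ∧ 0 < H :=
    ⟨max u v + 1, by linarith [le_max_left u v], by linarith [le_max_right u v],
      by linarith [le_max_left u v]⟩
  -- The square grows one side at a time: the first coordinate reaches `H` here, the second one
  -- below.
  have strip : ∀ u r, 0 < u → u < H → 0 < r → r < δ → E u r - 2 * ε ≤ 0 := by
    intro u r hu hu' hr hr'
    exact hsub.swap.nonpos_of_strip (U := δ) (H := H) (hmeas'.comp measurable_swap)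
      (fun u v => hM v u) hδ (by linarith) (fun a b c d e f => near b a e f c d) r u hr hr' hu hu'
  have hstrip' : ∀ u r, 0 < u → u < H → 0 < r → r < min δ H → E u r - 2 * ε ≤ 0 :=
    fun u r a b c d => strip u r a b c (d.trans_le (min_le_left _ _))
  have := hsub.nonpos_of_strip hmeas' hM (lt_min hδ hH)
    ((min_le_right δ H).trans (by linarith)) hstrip' u v hu huH hv hvH
  linarith

end MaximumPrinciples

open Filter Topology

/-! ### Lebesgue points of bounded measurable functions -/

section LebesguePoints

/-- `y` is a Lebesgue point of `g`. -/
def IsLebesguePoint (g : ℝ → ℝ) (y : ℝ) : Prop :=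
  ∀ ε > 0, ∃ δ > 0, ∀ h, 0 < h → h < δ → ∫ s in (y - h)..(y + h), |g s - g y| ≤ ε * h

theorem ae_isLebesguePoint {g : ℝ → ℝ} {M : ℝ} (hg : Measurable g) (hM : ∀ t, |g t| ≤ M) :
    ∀ᵐ y, IsLebesguePoint g y := by
  have hloc : LocallyIntegrable g (volume : Measure ℝ) := by
    refine (locallyIntegrable_const M).mono hg.aestronglyMeasurable ?_
    exact Eventually.of_forall fun t => by simpa using (hM t).trans (le_abs_self M)
  filter_upwards [IsUnifLocDoublingMeasure.ae_tendsto_average_norm_sub volume hloc 1] with y hy ε hε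
  have h1 := hy (l := 𝓝[>] (0 : ℝ)) (fun _ => y) (fun h => h) tendsto_id
    (by
      filter_upwards [self_mem_nhdsWithin] with h hh
      exact Metric.mem_closedBall_self (by simpa using (le_of_lt (mem_Ioi.1 hh))))
  -- The average is taken over an interval of length `2 * h`, hence `ε / 2`.
  have h2 := h1.eventually (gt_mem_nhds (half_pos hε))
  obtain ⟨δ, hδ, hsub⟩ := mem_nhdsGT_iff_exists_Ioo_subset.1 h2
  refine ⟨δ, hδ, fun h h0 hh => ?_⟩
  have h3 : ⨍ s in Metric.closedBall y h, ‖g s - g y‖ < ε / 2 := hsub ⟨h0, hh⟩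
  rw [setAverage_eq, Real.closedBall_eq_Icc, Measure.real, Real.volume_Icc,
    ENNReal.toReal_ofReal (by linarith), smul_eq_mul, ← div_eq_inv_mul,
    div_lt_iff₀ (by linarith), integral_Icc_eq_integral_Ioc,
    ← intervalIntegral.integral_of_le (by linarith)] at h3
  simp only [Real.norm_eq_abs] at h3
  linarith

theorem measurable_abs_sub_const {g : ℝ → ℝ} (hg : Measurable g) (y : ℝ) :
    Measurable fun s => |g s - g y| := by fun_prop

theorem IsLebesguePoint.right {g : ℝ → ℝ} {y M : ℝ} (h : IsLebesguePoint g y) (hg : Measurable g)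
    (hM : ∀ t, |g t| ≤ M) :
    ∀ ε > 0, ∃ δ > 0, ∀ h, 0 < h → h < δ → ∫ s in 0..h, |g (y + s) - g y| ≤ ε * h := by
  intro ε hε
  obtain ⟨δ, hδ, H⟩ := h ε hε
  refine ⟨δ, hδ, fun h h0 hh => ?_⟩
  have hb : ∀ s, |(fun s => |g s - g y|) s| ≤ M + M := fun s => by
    simp only [abs_abs]
    exact (abs_sub _ _).trans (add_le_add (hM _) (hM _))
  have i := intervalIntegrable_of_abs_le (measurable_abs_sub_const hg y) hb
  have h1 := intervalIntegral.integral_add_adjacent_intervals (i (y - h) y) (i y (y + h))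
  have h2 : 0 ≤ ∫ s in (y - h)..y, |g s - g y| :=
    intervalIntegral.integral_nonneg (by linarith) fun _ _ => abs_nonneg _
  rw [intervalIntegral.integral_comp_add_left (fun s => |g s - g y|), add_zero]
  linarith [H h h0 hh]

theorem IsLebesguePoint.left {g : ℝ → ℝ} {y M : ℝ} (h : IsLebesguePoint g y) (hg : Measurable g)
    (hM : ∀ t, |g t| ≤ M) :
    ∀ ε > 0, ∃ δ > 0, ∀ h, 0 < h → h < δ → ∫ s in 0..h, |g (y - s) - g y| ≤ ε * h := by
  intro ε hε
  obtain ⟨δ, hδ, H⟩ := h ε hε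
  refine ⟨δ, hδ, fun h h0 hh => ?_⟩
  have hb : ∀ s, |(fun s => |g s - g y|) s| ≤ M + M := fun s => by
    simp only [abs_abs]
    exact (abs_sub _ _).trans (add_le_add (hM _) (hM _))
  have i := intervalIntegrable_of_abs_le (measurable_abs_sub_const hg y) hb
  have h1 := intervalIntegral.integral_add_adjacent_intervals (i (y - h) y) (i y (y + h))
  have h2 : 0 ≤ ∫ s in y..(y + h), |g s - g y| :=
    intervalIntegral.integral_nonneg (by linarith) fun _ _ => abs_nonneg _
  rw [intervalIntegral.integral_comp_sub_left (fun s => |g s - g y|), sub_zero]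
  linarith [H h h0 hh]

end LebesguePoints

/-! ### One-sided limits of self-averaging functions -/

section SelfAveraging

/-- Measurable functions `p` of intervals with values in `[0,1]` such that `p x y` is the mean of
`p x t * p t y` over `t ∈ [x, y]`. -/
structure IsSelfAveraging (p : ℝ → ℝ → ℝ) : Prop where
  measurable : Measurable (Function.uncurry p)
  nonneg : ∀ x y, 0 ≤ p x y
  le_one : ∀ x y, p x y ≤ 1
  eq_integral : ∀ x y, x < y → (y - x) * p x y = ∫ t in x..y, p x t * p t y

/-- The mean of `p x` over `[x, x + h]`. -/
noncomputable def rightMean (p : ℝ → ℝ → ℝ) (x h : ℝ) : ℝ := (∫ t in x..(x + h), p x t) / h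

/-- The limit of the means of `p x` over `[x, x + h]` as `h` decreases to zero. -/
noncomputable def rightLimit (p : ℝ → ℝ → ℝ) (x : ℝ) : ℝ :=
  ⨆ n : ℕ, rightMean p x (1 / ((n : ℝ) + 1))

/-- The reflection of a function of intervals at the origin. -/
def reflect (p : ℝ → ℝ → ℝ) : ℝ → ℝ → ℝ := fun x y => p (-y) (-x)

namespace IsSelfAveraging

variable {p : ℝ → ℝ → ℝ} (hp : IsSelfAveraging p)

include hp

theorem reflect : IsSelfAveraging (reflect p) where
  measurable := hp.measurable.comp
    ((measurable_neg.comp measurable_snd).prodMk (measurable_neg.comp measurable_fst))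
  nonneg x y := hp.nonneg _ _
  le_one x y := hp.le_one _ _
  eq_integral x y hxy := by
    have h := hp.eq_integral (-y) (-x) (by linarith)
    rw [← intervalIntegral.integral_comp_neg] at h
    simp only [RandomHomeo.reflect]
    rw [show y - x = -x - -y by ring, h]
    exact intervalIntegral.integral_congr fun t _ => mul_comm _ _

theorem abs_le_one (x y : ℝ) : |p x y| ≤ 1 :=
  abs_le.2 ⟨by linarith [hp.nonneg x y], hp.le_one x y⟩

theorem measurable_left (y : ℝ) : Measurable fun x => p x y :=
  hp.measurable.comp (measurable_id.prodMk measurable_const)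

theorem measurable_right (x : ℝ) : Measurable (p x) :=
  hp.measurable.comp (measurable_const.prodMk measurable_id)

theorem intervalIntegrable_left (y a b : ℝ) : IntervalIntegrable (fun x => p x y) volume a b :=
  intervalIntegrable_of_abs_le (hp.measurable_left y) (fun t => hp.abs_le_one t y) a b

theorem intervalIntegrable_right (x a b : ℝ) : IntervalIntegrable (p x) volume a b :=
  intervalIntegrable_of_abs_le (hp.measurable_right x) (hp.abs_le_one x) a b

theorem intervalIntegrable_mul (x y a b : ℝ) :
    IntervalIntegrable (fun t => p x t * p t y) volume a b :=
  intervalIntegrable_of_abs_le (M := 1) ((hp.measurable_right x).mul (hp.measurable_left y))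
    (fun t => (abs_mul _ _).trans_le
      (mul_le_one₀ (hp.abs_le_one x t) (abs_nonneg _) (hp.abs_le_one t y))) a b

/-- Dropping the factor `p t y ≤ 1` from the averaging equation bounds each value of `p x` by the
mean of `p x` up to that point. Values beyond `x + h` therefore cannot exceed the mean up to `x +
h`. -/
theorem le_rightMean {x h y : ℝ} (h0 : 0 < h) (hy : x + h ≤ y) : p x y ≤ rightMean p x h := by
  have le : ∀ t, x < t → (t - x) * p x t ≤ ∫ s in x..t, p x s := by
    intro t ht
    rw [hp.eq_integral x t ht]
    refine intervalIntegral.integral_mono_on ht.le (hp.intervalIntegrable_mul _ _ _ _)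
      (hp.intervalIntegrable_right _ _ _) fun s _ => ?_
    exact mul_le_of_le_one_right (hp.nonneg _ _) (hp.le_one _ _)
  rcases hy.eq_or_lt with rfl | hy
  · rw [rightMean, le_div_iff₀ h0]
    have := le (x + h) (by linarith)
    linarith
  have key := nonpos_of_mul_le_integral (F := fun t => p x t - rightMean p x h) (x := x)
    (c := x + h) (H := y) (M := 1 + |rightMean p x h|) (by linarith) (by positivity)
    (fun t _ => by linarith [hp.le_one x t, neg_abs_le (rightMean p x h)])
    (fun t => (hp.intervalIntegrable_right _ _ _).sub intervalIntegrable_const) ?_ y ⟨hy, le_rfl⟩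
  · linarith
  intro t ht
  have e := hp.intervalIntegrable_right x
  rw [intervalIntegral.integral_sub (e _ _) intervalIntegrable_const,
    intervalIntegral.integral_const, smul_eq_mul]
  have h1 := le t (by linarith [ht.1])
  rw [← intervalIntegral.integral_add_adjacent_intervals (e x (x + h)) (e (x + h) t)] at h1
  have h2 : ∫ s in x..(x + h), p x s = rightMean p x h * h := by
    rw [rightMean, div_mul_cancel₀ _ h0.ne']
  linarith

/-- Lengthening the interval only adds values not above the mean. This makes the supremum in
`rightLimit` a limit as `h` decreases to `0`. -/
theorem rightMean_anti {x h h' : ℝ} (h0 : 0 < h) (hh : h ≤ h') :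
    rightMean p x h' ≤ rightMean p x h := by
  have e := hp.intervalIntegrable_right x
  have h2 : ∫ s in x..(x + h), p x s = rightMean p x h * h := by
    rw [rightMean, div_mul_cancel₀ _ h0.ne']
  have h3 : ∫ s in (x + h)..(x + h'), p x s ≤ ((x + h') - (x + h)) * rightMean p x h :=
    intervalIntegral_le_mul (by linarith) (e _ _) fun s hs => hp.le_rightMean h0 hs.1.le
  rw [rightMean, div_le_iff₀ (h0.trans_le hh),
    ← intervalIntegral.integral_add_adjacent_intervals (e x (x + h)) (e (x + h) (x + h'))]
  linarith

theorem rightMean_nonneg {x h : ℝ} (h0 : 0 < h) : 0 ≤ rightMean p x h :=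
  div_nonneg (intervalIntegral.integral_nonneg (by linarith) fun t _ => hp.nonneg x t) h0.le

theorem rightMean_le_one {x h : ℝ} (h0 : 0 < h) : rightMean p x h ≤ 1 := by
  rw [rightMean, div_le_iff₀ h0]
  have := intervalIntegral_le_mul (a := x) (b := x + h) (by linarith)
    (hp.intervalIntegrable_right x _ _) fun t _ => hp.le_one x t
  linarith

theorem bddAbove_rightMean (x : ℝ) :
    BddAbove (range fun n : ℕ => rightMean p x (1 / ((n : ℝ) + 1))) := by
  refine ⟨1, ?_⟩
  rintro _ ⟨n, rfl⟩
  exact hp.rightMean_le_one (by positivity)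

theorem rightMean_le_rightLimit {x h : ℝ} (h0 : 0 < h) : rightMean p x h ≤ rightLimit p x := by
  obtain ⟨n, hn⟩ := exists_nat_one_div_lt h0
  exact (hp.rightMean_anti (by positivity) hn.le).trans (le_ciSup (hp.bddAbove_rightMean x) n)

theorem le_rightLimit {x y : ℝ} (hxy : x < y) : p x y ≤ rightLimit p x :=
  (hp.le_rightMean (sub_pos.2 hxy) (by linarith)).trans (hp.rightMean_le_rightLimit (sub_pos.2 hxy))

theorem rightLimit_le {x C δ : ℝ} (hδ : 0 < δ)
    (h : ∀ h, 0 < h → h < δ → rightMean p x h ≤ C) : rightLimit p x ≤ C := by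
  refine ciSup_le fun n => ?_
  have hn : (0 : ℝ) < 1 / ((n : ℝ) + 1) := by positivity
  have h0 : 0 < min (1 / ((n : ℝ) + 1)) (δ / 2) := lt_min hn (half_pos hδ)
  exact (hp.rightMean_anti h0 (min_le_left _ _)).trans
    (h _ h0 ((min_le_right _ _).trans_lt (half_lt_self hδ)))

theorem rightLimit_nonneg (x : ℝ) : 0 ≤ rightLimit p x :=
  (hp.rightMean_nonneg one_pos).trans (hp.rightMean_le_rightLimit one_pos)

theorem rightLimit_le_one (x : ℝ) : rightLimit p x ≤ 1 :=
  hp.rightLimit_le one_pos fun _ h0 _ => hp.rightMean_le_one h0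

theorem abs_rightLimit_le_one (x : ℝ) : |rightLimit p x| ≤ 1 :=
  abs_le.2 ⟨by linarith [hp.rightLimit_nonneg x], hp.rightLimit_le_one x⟩

omit hp in
theorem exists_lt_rightMean (x : ℝ) {ε : ℝ} (hε : 0 < ε) :
    ∃ n : ℕ, rightLimit p x - ε < rightMean p x (1 / ((n : ℝ) + 1)) :=
  exists_lt_of_lt_ciSup (sub_lt_self _ hε)

theorem measurable_rightMean {h : ℝ} (h0 : 0 < h) : Measurable fun x => rightMean p x h := by
  refine Measurable.div_const ?_ h
  have : ∀ x, ∫ t in x..(x + h), p x t = ∫ s in Ioc 0 h, p x (x + s) := by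
    intro x
    rw [← intervalIntegral.integral_of_le h0.le, intervalIntegral.integral_comp_add_left, add_zero]
  simp_rw [this]
  have hm : Measurable (Function.uncurry fun x s : ℝ => p x (x + s)) :=
    hp.measurable.comp (measurable_fst.prodMk (measurable_fst.add measurable_snd))
  exact (hm.stronglyMeasurable.integral_prod_right (ν := volume.restrict (Ioc 0 h))).measurable

theorem measurable_rightLimit : Measurable (rightLimit p) :=
  Measurable.iSup fun _ => hp.measurable_rightMean (by positivity)

theorem rightLimit_le_of_forall_le {x C δ : ℝ} (hδ : 0 < δ)
    (h : ∀ s, 0 < s → s < δ → p x (x + s) ≤ C) : rightLimit p x ≤ C := by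
  refine hp.rightLimit_le hδ fun s hs hsδ => ?_
  rw [rightMean, div_le_iff₀ hs]
  have := intervalIntegral_le_mul (a := x) (b := x + s) (by linarith)
    (hp.intervalIntegrable_right x _ _) (C := C) fun t ht => by
      have := h (t - x) (by linarith [ht.1]) (by linarith [ht.2])
      rwa [add_sub_cancel] at this
  linarith

/-- In the averaging equation on a short interval `[x, x + s]`, the second factor is at most
`rightLimit p (x + t)`, on average close to `rightLimit p x`, while the first has mean at most
`rightLimit p x`. As the limit lies in `[0, 1]`, it must be `0` or `1` here. -/
theorem rightLimit_le_sq {x : ℝ} (hx : IsLebesguePoint (rightLimit p) x) :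
    rightLimit p x ≤ rightLimit p x * rightLimit p x := by
  refine le_of_forall_pos_le_add fun ε hε => ?_
  obtain ⟨δ, hδ, H⟩ := hx.right hp.measurable_rightLimit hp.abs_rightLimit_le_one ε hε
  refine hp.rightLimit_le_of_forall_le hδ fun s hs hsδ => ?_
  set a := rightLimit p x with ha
  have e1 : IntervalIntegrable (fun t => p x (x + t) * a) volume 0 s :=
    intervalIntegrable_of_abs_le (M := 1)
      (((hp.measurable_right x).comp (measurable_const.add measurable_id)).mul_const a)
      (fun t => (abs_mul _ _).trans_le (mul_le_one₀ (hp.abs_le_one _ _) (abs_nonneg _)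
        (hp.abs_rightLimit_le_one _))) _ _
  have e2 : IntervalIntegrable (fun t => |rightLimit p (x + t) - a|) volume 0 s :=
    intervalIntegrable_of_abs_le (M := 1 + 1)
      ((measurable_abs_sub_const hp.measurable_rightLimit x).comp
        (measurable_const.add measurable_id))
      (fun t => (abs_abs _).trans_le ((abs_sub _ _).trans
        (add_le_add (hp.abs_rightLimit_le_one _) (hp.abs_rightLimit_le_one _)))) _ _
  have h1 := hp.eq_integral x (x + s) (by linarith)
  rw [add_sub_cancel_left] at h1
  have h2 : ∫ t in x..(x + s), p x t * p t (x + s)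
      = ∫ t in 0..s, p x (x + t) * p (x + t) (x + s) := by
    rw [intervalIntegral.integral_comp_add_left (fun t => p x t * p t (x + s)), add_zero]
  have e4 : IntervalIntegrable (fun t => p x (x + t) * p (x + t) (x + s)) volume 0 s :=
    intervalIntegrable_of_abs_le (M := 1)
      (((hp.measurable_right x).comp (measurable_const.add measurable_id)).mul
        ((hp.measurable_left (x + s)).comp (measurable_const.add measurable_id)))
      (fun t => (abs_mul _ _).trans_le
        (mul_le_one₀ (hp.abs_le_one _ _) (abs_nonneg _) (hp.abs_le_one _ _))) _ _
  have h3 := intervalIntegral.integral_mono_on_of_le_Ioo hs.le e4 (e1.add e2) fun t ht => by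
    have l1 : p (x + t) (x + s) ≤ rightLimit p (x + t) := hp.le_rightLimit (by linarith [ht.2])
    have l2 : rightLimit p (x + t) ≤ a + |rightLimit p (x + t) - a| := by
      linarith [le_abs_self (rightLimit p (x + t) - a)]
    calc p x (x + t) * p (x + t) (x + s)
        ≤ p x (x + t) * (a + |rightLimit p (x + t) - a|) :=
          mul_le_mul_of_nonneg_left (l1.trans l2) (hp.nonneg _ _)
      _ = p x (x + t) * a + p x (x + t) * |rightLimit p (x + t) - a| := mul_add _ _ _
      _ ≤ p x (x + t) * a + |rightLimit p (x + t) - a| :=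
          add_le_add_right (mul_le_of_le_one_left (abs_nonneg _) (hp.le_one _ _)) _
  rw [intervalIntegral.integral_add e1 e2, intervalIntegral.integral_mul_const,
    intervalIntegral.integral_comp_add_left (p x), add_zero] at h3
  have h4 : ∫ t in x..(x + s), p x t = rightMean p x s * s := by
    rw [rightMean, div_mul_cancel₀ _ hs.ne']
  have h5 : rightMean p x s * a ≤ a * a :=
    mul_le_mul_of_nonneg_right (hp.rightMean_le_rightLimit hs) (hp.rightLimit_nonneg x)
  have h6 := H s hs hsδ
  rw [h2] at h1
  rw [h4] at h3
  have h7 : s * p x (x + s) ≤ s * (a * a + ε) := by nlinarith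
  exact le_of_mul_le_mul_left h7 hs

theorem le_rightLimit_reflect {x y : ℝ} (hxy : x < y) :
    p x y ≤ rightLimit (RandomHomeo.reflect p) (-y) := by
  have := hp.reflect.le_rightLimit (neg_lt_neg hxy)
  simpa [RandomHomeo.reflect] using this

/-- Each `p x (x + t)` is bounded by the left limit at `x + t`; averaging over small `t` gives the
left limit at `x`, by the Lebesgue point hypothesis. -/
theorem rightLimit_le_rightLimit_reflect {x : ℝ}
    (hx : IsLebesguePoint (fun y => rightLimit (RandomHomeo.reflect p) (-y)) x) :
    rightLimit p x ≤ rightLimit (RandomHomeo.reflect p) (-x) := by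
  refine le_of_forall_pos_le_add fun ε hε => ?_
  obtain ⟨δ, hδ, H⟩ := hx.right (hp.reflect.measurable_rightLimit.comp measurable_neg)
    (fun t => hp.reflect.abs_rightLimit_le_one (-t)) ε hε
  set b := fun y => rightLimit (RandomHomeo.reflect p) (-y) with hb
  have hbm : Measurable b := hp.reflect.measurable_rightLimit.comp measurable_neg
  have hb1 : ∀ y, |b y| ≤ 1 := fun y => hp.reflect.abs_rightLimit_le_one _
  change _ ≤ b x + ε
  refine hp.rightLimit_le hδ fun s hs hsδ => ?_
  have e1 : IntervalIntegrable (fun t => |b (x + t) - b x|) volume 0 s :=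
    intervalIntegrable_of_abs_le (M := 1 + 1)
      ((measurable_abs_sub_const hbm x).comp (measurable_const.add measurable_id))
      (fun t => (abs_abs _).trans_le ((abs_sub _ _).trans (add_le_add (hb1 _) (hb1 _)))) _ _
  have e2 : IntervalIntegrable (fun t => p x (x + t)) volume 0 s :=
    intervalIntegrable_of_abs_le (M := 1)
      ((hp.measurable_right x).comp (measurable_const.add measurable_id))
      (fun t => hp.abs_le_one _ _) _ _
  have h1 := intervalIntegral.integral_mono_on_of_le_Ioo hs.le e2
    ((intervalIntegrable_const (c := b x)).add e1) fun t ht => by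
      have l1 : p x (x + t) ≤ b (x + t) := hp.le_rightLimit_reflect (by linarith [ht.1])
      linarith [le_abs_self (b (x + t) - b x)]
  rw [intervalIntegral.integral_add intervalIntegrable_const e1,
    intervalIntegral.integral_comp_add_left (p x), add_zero, intervalIntegral.integral_const,
    smul_eq_mul] at h1
  rw [rightMean, div_le_iff₀ hs]
  linarith [H s hs hsδ]

omit hp in
theorem reflect_reflect (p : ℝ → ℝ → ℝ) : RandomHomeo.reflect (RandomHomeo.reflect p) = p := by
  funext x y
  simp [RandomHomeo.reflect]

theorem ae_rightLimit_eq : ∀ᵐ y, rightLimit p y = rightLimit (RandomHomeo.reflect p) (-y) ∧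
    rightLimit p y * rightLimit p y = rightLimit p y := by
  have h1 := ae_isLebesguePoint hp.measurable_rightLimit hp.abs_rightLimit_le_one
  have h2 := ae_isLebesguePoint (hp.reflect.measurable_rightLimit.comp measurable_neg)
    (fun t => hp.reflect.abs_rightLimit_le_one (-t))
  -- Needed for the reverse inequality, which is the previous lemma for `reflect p` at `-y`.
  have h3 := ae_isLebesguePoint (hp.measurable_rightLimit.comp measurable_neg)
    (fun t => hp.abs_rightLimit_le_one (-t))
  have h4 := (Measure.measurePreserving_neg (volume : Measure ℝ)).quasiMeasurePreserving.ae h3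
  filter_upwards [h1, h2, h4] with y h1 h2 h4
  refine ⟨le_antisymm (hp.rightLimit_le_rightLimit_reflect h2) ?_, le_antisymm ?_ ?_⟩
  · have := hp.reflect.rightLimit_le_rightLimit_reflect (x := -y)
      (by rw [reflect_reflect]; exact h4)
    rwa [reflect_reflect, neg_neg] at this
  · exact mul_le_of_le_one_right (hp.rightLimit_nonneg _) (hp.rightLimit_le_one _)
  · exact hp.rightLimit_le_sq h1

/-- Means over rectangles that are higher than wide. -/
theorem ae_rectangle_le : ∀ᵐ y, ∀ ε > 0, ∃ δ > 0, ∀ u v, 0 < u → u ≤ v → v < δ →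
    ∫ s in 0..u, ∫ r in 0..v, |p (y - s) (y + r) - rightLimit p y| ≤ ε * u * v := by
  have gm : ∀ n : ℕ, Measurable fun x => rightLimit p x - rightMean p x (1 / ((n : ℝ) + 1)) :=
    fun n => hp.measurable_rightLimit.sub (hp.measurable_rightMean (by positivity))
  have gb : ∀ (n : ℕ) x, |rightLimit p x - rightMean p x (1 / ((n : ℝ) + 1))| ≤ 1 := by
    intro n x
    have hn : (0 : ℝ) < 1 / ((n : ℝ) + 1) := by positivity
    have b1 := hp.rightMean_le_rightLimit (x := x) hn
    have b2 := hp.rightLimit_le_one x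
    have b3 := hp.rightMean_nonneg (x := x) hn
    exact abs_le.2 ⟨by linarith, by linarith⟩
  have h1 := ae_isLebesguePoint hp.measurable_rightLimit hp.abs_rightLimit_le_one
  -- The scale `η` chosen below depends on `y`; restricting it to the values `1 / (n + 1)` leaves
  -- countably many exceptional null sets.
  have h2 := ae_all_iff.2 fun n => ae_isLebesguePoint (gm n) (gb n)
  filter_upwards [h1, h2] with y h1 h2 ε' hε'
  -- Two `ε` come from the size of `g` at `y`, two from its oscillation, one from the oscillation of
  -- `a`.
  obtain ⟨ε, hε, rfl⟩ : ∃ ε, 0 < ε ∧ ε' = 5 * ε := ⟨ε' / 5, by linarith, by ring⟩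
  set a := rightLimit p with ha
  obtain ⟨n, hn⟩ := exists_lt_rightMean (p := p) y hε
  have hn0 : (0 : ℝ) < 1 / ((n : ℝ) + 1) := by positivity
  set η := 1 / ((n : ℝ) + 1) with hη
  set g := fun x => a x - rightMean p x η with hg
  have gm' : Measurable g := gm n
  have gb' : ∀ x, |g x| ≤ 1 := gb n
  obtain ⟨δ₁, hδ₁, H1⟩ := h1.left hp.measurable_rightLimit hp.abs_rightLimit_le_one ε hε
  obtain ⟨δ₂, hδ₂, H2⟩ := (h2 n).left (gm n) (gb n) ε hε
  refine ⟨min (min δ₁ δ₂) (η / 2), lt_min (lt_min hδ₁ hδ₂) (half_pos hn0), fun u v hu huv hv => ?_⟩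
  have hv1 : v < δ₁ := hv.trans_le ((min_le_left _ _).trans (min_le_left _ _))
  have hv2 : v < δ₂ := hv.trans_le ((min_le_left _ _).trans (min_le_right _ _))
  have hv3 : v < η / 2 := hv.trans_le (min_le_right _ _)
  have hv0 : 0 < v := hu.trans_le huv
  have hgy : g y < ε := by
    simp only [hg]
    linarith
  have Km : Measurable (Function.uncurry fun s r : ℝ => |p (y - s) (y + r) - a y|) := by
    have := hp.measurable.comp (f := fun q : ℝ × ℝ => (y - q.1, y + q.2)) (by fun_prop)
    exact _root_.continuous_abs.measurable.comp (this.sub_const (a y))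
  have Kb : ∀ s r : ℝ, |p (y - s) (y + r) - a y| ≤ 1 + 1 := fun s r =>
    (abs_sub _ _).trans (add_le_add (hp.abs_le_one _ _) (hp.abs_rightLimit_le_one _))
  have inner : ∀ s ∈ Ioo 0 u, ∫ r in 0..v, |p (y - s) (y + r) - a y| ≤
      v * (2 * |g (y - s) - g y| + 2 * ε + |a (y - s) - a y|) := by
    intro s hs
    set l := y - s with hl
    have i1 : ∀ b c, IntervalIntegrable (fun r => a l - p l r) volume b c := fun b c =>
      intervalIntegrable_const.sub (hp.intervalIntegrable_right l b c)
    have i2 : IntervalIntegrable (fun r => a l - p l (y + r)) volume 0 v :=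
      intervalIntegrable_of_abs_le (M := 1 + 1) (measurable_const.sub
        ((hp.measurable_right l).comp (measurable_const.add measurable_id)))
        (fun r => (abs_sub _ _).trans
          (add_le_add (hp.abs_rightLimit_le_one _) (hp.abs_le_one _ _))) _ _
    have i3 : IntervalIntegrable (fun r => |p l (y + r) - a y|) volume 0 v :=
      intervalIntegrable_of_abs_le (F := fun r => |p l (y + r) - a y|) (M := 1 + 1)
        (Km.comp (measurable_const.prodMk measurable_id))
        (fun r => (abs_abs _).trans_le (Kb s r)) _ _
    have h3 := intervalIntegral.integral_mono_on_of_le_Ioo hv0.le i3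
      (i2.add (intervalIntegrable_const (c := |a l - a y|))) fun r hr => by
        have l1 : p l (y + r) ≤ a l := hp.le_rightLimit (by linarith [hs.1, hr.1])
        calc |p l (y + r) - a y| ≤ |p l (y + r) - a l| + |a l - a y| := abs_sub_le _ _ _
          _ = (a l - p l (y + r)) + |a l - a y| := by
            rw [abs_sub_comm, abs_of_nonneg (sub_nonneg.2 l1)]
    rw [intervalIntegral.integral_add i2 intervalIntegrable_const,
      intervalIntegral.integral_comp_add_left (fun r => a l - p l r), add_zero,
      intervalIntegral.integral_const, smul_eq_mul] at h3
    -- The integrand is nonnegative to the right of `l`, and `s < u ≤ v` places `[y, y + v]` inside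
    -- `[l, l + 2 * v]`. This is where the shape of the rectangle matters.
    have h4 : ∫ r in y..(y + v), (a l - p l r) ≤ ∫ r in l..(l + 2 * v), (a l - p l r) := by
      rw [intervalIntegral.integral_of_le (by linarith),
        intervalIntegral.integral_of_le (by linarith)]
      refine setIntegral_mono_set (i1 l (l + 2 * v)).1 ?_ ?_
      · filter_upwards [ae_restrict_mem measurableSet_Ioc] with r hr
        exact sub_nonneg.2 (hp.le_rightLimit hr.1)
      · refine (Ioc_subset_Ioc ?_ ?_).eventuallyLE
        · linarith [hs.1]
        · linarith [hs.2]
    rw [intervalIntegral.integral_sub (a := l) intervalIntegrable_const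
      (hp.intervalIntegrable_right _ _ _), intervalIntegral.integral_const, smul_eq_mul] at h4
    have h5 : ∫ t in l..(l + 2 * v), p l t = rightMean p l (2 * v) * (2 * v) := by
      rw [rightMean, div_mul_cancel₀ _ (by positivity)]
    have h6 : rightMean p l η ≤ rightMean p l (2 * v) :=
      hp.rightMean_anti (by positivity) (by linarith)
    have h7 : g l ≤ |g l - g y| + ε := by linarith [le_abs_self (g l - g y)]
    have h8 : a l - rightMean p l (2 * v) ≤ |g l - g y| + ε := by
      refine le_trans ?_ h7
      simp only [hg]
      linarith
    rw [h5] at h4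
    have h9 := mul_le_mul_of_nonneg_left h8 (by positivity : 0 ≤ 2 * v)
    linarith
  have j1 : IntervalIntegrable (fun s => ∫ r in 0..v, |p (y - s) (y + r) - a y|) volume 0 u := by
    refine intervalIntegrable_of_abs_le (M := (v - 0) * (1 + 1)) ?_ (fun s => ?_) _ _
    · simp_rw [intervalIntegral.integral_of_le hv0.le]
      exact (Km.stronglyMeasurable.integral_prod_right (ν := volume.restrict (Ioc 0 v))).measurable
    · rw [abs_of_nonneg (intervalIntegral.integral_nonneg hv0.le fun r _ => abs_nonneg _)]
      exact intervalIntegral_le_mul hv0.le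
        (intervalIntegrable_of_abs_le (F := fun r => |p (y - s) (y + r) - a y|)
          (Km.comp (measurable_const.prodMk measurable_id))
          (fun r => (abs_abs _).trans_le (Kb s r)) _ _) fun r _ => Kb s r
  have jg : IntervalIntegrable (fun s => |g (y - s) - g y|) volume 0 u :=
    intervalIntegrable_of_abs_le (M := 1 + 1)
      ((measurable_abs_sub_const gm' y).comp (measurable_const.sub measurable_id))
      (fun t => (abs_abs _).trans_le ((abs_sub _ _).trans (add_le_add (gb' _) (gb' _)))) _ _
  have ja : IntervalIntegrable (fun s => |a (y - s) - a y|) volume 0 u :=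
    intervalIntegrable_of_abs_le (M := 1 + 1)
      ((measurable_abs_sub_const hp.measurable_rightLimit y).comp
        (measurable_const.sub measurable_id))
      (fun t => (abs_abs _).trans_le ((abs_sub _ _).trans
        (add_le_add (hp.abs_rightLimit_le_one _) (hp.abs_rightLimit_le_one _)))) _ _
  have outer := intervalIntegral.integral_mono_on_of_le_Ioo hu.le j1
    ((((jg.const_mul 2).add (intervalIntegrable_const (c := 2 * ε))).add ja).const_mul v) inner
  rw [intervalIntegral.integral_const_mul,
    intervalIntegral.integral_add ((jg.const_mul 2).add intervalIntegrable_const) ja,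
    intervalIntegral.integral_add (jg.const_mul 2) intervalIntegrable_const,
    intervalIntegral.integral_const_mul, intervalIntegral.integral_const, smul_eq_mul] at outer
  have o1 := H1 u hu (by linarith)
  have o2 : ∫ s in 0..u, |g (y - s) - g y| ≤ ε * u := H2 u hu (by linarith)
  have o3 : 2 * (∫ s in 0..u, |g (y - s) - g y|) + (u - 0) * (2 * ε)
      + ∫ s in 0..u, |a (y - s) - a y| ≤ 5 * ε * u := by linarith
  exact outer.trans ((mul_le_mul_of_nonneg_left o3 hv0.le).trans_eq (by ring))

end IsSelfAveraging

end SelfAveraging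

/-! ### Vanishing of the multiplicative defect -/

section Multiplicativity

/-- The failure of multiplicativity of `p` at `y`, for the interval `[y - u, y + v]`. -/
def mulDefect (p : ℝ → ℝ → ℝ) (y u v : ℝ) : ℝ :=
  |p (y - u) (y + v) - p (y - u) y * p y (y + v)|

namespace IsSelfAveraging

variable {p : ℝ → ℝ → ℝ} (hp : IsSelfAveraging p)

include hp

theorem measurable_mulDefect (y : ℝ) : Measurable (Function.uncurry (mulDefect p y)) := by
  have h1 := hp.measurable.comp (f := fun q : ℝ × ℝ => (y - q.1, y + q.2)) (by fun_prop)
  have h2 := hp.measurable.comp (f := fun q : ℝ × ℝ => (y - q.1, y)) (by fun_prop)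
  have h3 := hp.measurable.comp (f := fun q : ℝ × ℝ => (y, y + q.2)) (by fun_prop)
  exact _root_.continuous_abs.measurable.comp (h1.sub (h2.mul h3))

theorem mulDefect_le_one (y u v : ℝ) : mulDefect p y u v ≤ 1 := by
  have h1 := hp.nonneg (y - u) (y + v)
  have h2 := hp.le_one (y - u) (y + v)
  have h3 := mul_nonneg (hp.nonneg (y - u) y) (hp.nonneg y (y + v))
  have h4 := mul_le_one₀ (hp.le_one (y - u) y) (hp.nonneg y (y + v)) (hp.le_one y (y + v))
  exact abs_le.2 ⟨by linarith, by linarith⟩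

/-- Apply the averaging equation to `[x, z]`, `[x, y]` and `[y, z]` and cut the first integral at
`y`. For `t < y` the difference of integrands is `p x t` times the signed defect of `[t, z]`; for `t
> y` it is `p t z` times that of `[x, t]`. The extra factors are at most `1`. -/
theorem isSubharmonic_mulDefect (y : ℝ) : IsSubharmonic (mulDefect p y) := by
  intro u v hu hv
  set x := y - u with hx
  set z := y + v with hz
  have hxy : x < y := by linarith
  have hyz : y < z := by linarith
  have iM := hp.intervalIntegrable_mul
  have J : ∀ x' y' z' a b,
      IntervalIntegrable (fun t => p x' t * p t y' * z') volume a b :=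
    fun x' y' z' a b => (iM x' y' a b).mul_const z'
  have J' : ∀ x' y' z' a b,
      IntervalIntegrable (fun t => z' * (p x' t * p t y')) volume a b :=
    fun x' y' z' a b => (iM x' y' a b).const_mul z'
  have e1 := hp.eq_integral x z (hxy.trans hyz)
  rw [← intervalIntegral.integral_add_adjacent_intervals (iM x z x y) (iM x z y z)] at e1
  have e2 : (y - x) * p x y * p y z = ∫ t in x..y, p x t * p t y * p y z := by
    rw [hp.eq_integral x y hxy, intervalIntegral.integral_mul_const]
  have e3 : p x y * ((z - y) * p y z) = ∫ t in y..z, p x y * (p y t * p t z) := by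
    rw [hp.eq_integral y z hyz, intervalIntegral.integral_const_mul]
  have e4 : (u + v) * (p x z - p x y * p y z) =
      (∫ t in x..y, (p x t * p t z - p x t * p t y * p y z)) +
        ∫ t in y..z, (p x t * p t z - p x y * (p y t * p t z)) := by
    rw [intervalIntegral.integral_sub (iM _ _ _ _) (J _ _ _ _ _),
      intervalIntegral.integral_sub (iM _ _ _ _) (J' _ _ _ _ _), ← e2, ← e3]
    have : u + v = z - x := by simp only [hx, hz]; ring
    rw [this]
    linear_combination e1
  have m := hp.measurable_mulDefect y
  have mb : ∀ a b, |mulDefect p y a b| ≤ 1 := fun a b =>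
    (abs_abs _).trans_le (hp.mulDefect_le_one y a b)
  have k1 : |∫ t in x..y, (p x t * p t z - p x t * p t y * p y z)| ≤
      ∫ s in 0..u, mulDefect p y s v := by
    have : ∫ s in 0..u, mulDefect p y s v = ∫ t in x..y, mulDefect p y (y - t) v := by
      rw [intervalIntegral.integral_comp_sub_left (fun s => mulDefect p y s v), sub_self, hx,
        sub_sub_cancel]
    rw [this]
    refine (intervalIntegral.abs_integral_le_integral_abs hxy.le).trans
      (intervalIntegral.integral_mono_on hxy.le ((iM _ _ _ _).sub (J _ _ _ _ _)).abs
        (intervalIntegrable_of_abs_le (F := fun t => mulDefect p y (y - t) v) (m.comp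
          ((measurable_const.sub measurable_id).prodMk measurable_const)) (fun t => mb _ _) _ _)
        fun t _ => ?_)
    rw [mulDefect, sub_sub_cancel, mul_assoc, ← mul_sub, abs_mul, abs_of_nonneg (hp.nonneg x t)]
    exact mul_le_of_le_one_left (abs_nonneg _) (hp.le_one _ _)
  have k2 : |∫ t in y..z, (p x t * p t z - p x y * (p y t * p t z))| ≤
      ∫ r in 0..v, mulDefect p y u r := by
    have : ∫ r in 0..v, mulDefect p y u r = ∫ t in y..z, mulDefect p y u (t - y) := by
      rw [intervalIntegral.integral_comp_sub_right (mulDefect p y u), sub_self, hz,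
        add_sub_cancel_left]
    rw [this]
    refine (intervalIntegral.abs_integral_le_integral_abs hyz.le).trans
      (intervalIntegral.integral_mono_on hyz.le ((iM _ _ _ _).sub (J' _ _ _ _ _)).abs
        (intervalIntegrable_of_abs_le (F := fun t => mulDefect p y u (t - y)) (m.comp
          (measurable_const.prodMk (measurable_id.sub measurable_const))) (fun t => mb _ _) _ _)
        fun t _ => ?_)
    rw [mulDefect, add_sub_cancel, ← mul_assoc, ← sub_mul, abs_mul, abs_of_nonneg (hp.nonneg t z)]
    exact mul_le_of_le_one_right (abs_nonneg _) (hp.le_one _ _)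
  have huv : 0 ≤ u + v := by linarith
  calc (u + v) * mulDefect p y u v = |(u + v) * (p x z - p x y * p y z)| := by
        rw [abs_mul, abs_of_nonneg huv, mulDefect]
    _ ≤ _ := by
        rw [e4]
        exact (abs_add_le _ _).trans (add_le_add k1 k2)

/-- Both one-sided values at `y` are at most `c`, and `c` is idempotent, so their product is
compared with `c * c = c`. -/
theorem mulDefect_le {y u v c : ℝ} (hu : 0 < u) (hv : 0 < v) (hc : c = rightLimit p y)
    (hc' : c = rightLimit (RandomHomeo.reflect p) (-y)) (hcc : c * c = c) :
    mulDefect p y u v ≤ |p (y - u) (y + v) - c| + ((c - p (y - u) y) + (c - p y (y + v))) := by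
  have h1 : p (y - u) y ≤ c := hc' ▸ hp.le_rightLimit_reflect (by linarith)
  have h2 : p y (y + v) ≤ c := hc ▸ hp.le_rightLimit (by linarith)
  have h3 := hp.nonneg (y - u) y
  have h4 := hp.nonneg y (y + v)
  have h5 : c ≤ 1 := hc ▸ hp.rightLimit_le_one y
  have h6 : |c - p (y - u) y * p y (y + v)| ≤ (c - p (y - u) y) + (c - p y (y + v)) := by
    rw [abs_of_nonneg]
    · nlinarith [mul_nonneg (sub_nonneg.2 h1) (sub_nonneg.2 h2)]
    · nlinarith
  exact (abs_sub_le _ c _).trans (add_le_add_right h6 _)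

/-- Means over all rectangles. -/
theorem ae_rectangle_le' : ∀ᵐ y, ∀ ε > 0, ∃ δ > 0, ∀ u v, 0 < u → u < δ → 0 < v → v < δ →
    ∫ s in 0..u, ∫ r in 0..v, |p (y - s) (y + r) - rightLimit p y| ≤ ε * u * v := by
  have h2 := (Measure.measurePreserving_neg (volume : Measure ℝ)).quasiMeasurePreserving.ae
    hp.reflect.ae_rectangle_le
  filter_upwards [hp.ae_rectangle_le, h2, hp.ae_rightLimit_eq] with y h1 h2 h3 ε hε
  obtain ⟨δ₁, hδ₁, H1⟩ := h1 ε hε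
  obtain ⟨δ₂, hδ₂, H2⟩ := h2 ε hε
  refine ⟨min δ₁ δ₂, lt_min hδ₁ hδ₂, fun u v hu huδ hv hvδ => ?_⟩
  rcases le_total u v with huv | huv
  · exact H1 u v hu huv (hvδ.trans_le (min_le_left _ _))
  -- Wide rectangles are the high rectangles of the reflected function, with the order of
  -- integration exchanged.
  · have := H2 v u hv huv (huδ.trans_le (min_le_right _ _))
    have Km : Measurable (Function.uncurry fun s r : ℝ => |p (y - s) (y + r) - rightLimit p y|) := by
      have := hp.measurable.comp (f := fun q : ℝ × ℝ => (y - q.1, y + q.2)) (by fun_prop)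
      exact _root_.continuous_abs.measurable.comp (this.sub_const (rightLimit p y))
    rw [intervalIntegral_swap_of_abs_le Km (M := 1 + 1) fun s r =>
      (abs_abs _).trans_le ((abs_sub _ _).trans
        (add_le_add (hp.abs_le_one _ _) (hp.abs_rightLimit_le_one _)))]
    rw [← h3.1] at this
    refine (le_of_eq ?_).trans (this.trans_eq (by ring))
    refine intervalIntegral.integral_congr fun r _ => intervalIntegral.integral_congr fun s _ => ?_
    simp only [RandomHomeo.reflect]
    rw [show -(-y + s) = y - s by ring, show -(-y - r) = y + r by ring]

/-- Integrating `mulDefect_le` over a small rectangle leaves three small means: `|p - c|` over the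
rectangle and the deficits of the two one-sided means. The maximum principle on the quadrant then
applies. -/
theorem ae_mulDefect_eq_zero : ∀ᵐ y, ∀ u v, 0 < u → 0 < v → mulDefect p y u v = 0 := by
  filter_upwards [hp.ae_rectangle_le', hp.ae_rightLimit_eq] with y hrect hy u v hu hv
  refine (hp.isSubharmonic_mulDefect y).eq_zero (hp.measurable_mulDefect y)
    (fun _ _ => abs_nonneg _) (hp.mulDefect_le_one y) (fun ε' hε' => ?_) hu hv
  obtain ⟨ε, hε, rfl⟩ : ∃ ε, 0 < ε ∧ ε' = 3 * ε := ⟨ε' / 3, by linarith, by ring⟩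
  obtain ⟨δ, hδ, H⟩ := hrect ε hε
  obtain ⟨n, hn⟩ := exists_lt_rightMean (p := p) y hε
  obtain ⟨m, hm⟩ := exists_lt_rightMean (p := RandomHomeo.reflect p) (-y) hε
  set c := rightLimit p y with hc
  obtain ⟨hc', hcc⟩ := hy
  rw [← hc'] at hm
  refine ⟨min δ (min (1 / ((n : ℝ) + 1)) (1 / ((m : ℝ) + 1))),
    lt_min hδ (lt_min (by positivity) (by positivity)), fun u v hu hu' hv hv' => ?_⟩
  simp only [lt_min_iff] at hu' hv'
  have hA : c - rightMean p y v ≤ ε := by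
    linarith [hp.rightMean_anti (x := y) hv hv'.2.1.le]
  have hB : c - rightMean (RandomHomeo.reflect p) (-y) u ≤ ε := by
    linarith [hp.reflect.rightMean_anti (x := -y) hu hu'.2.2.le]
  have hA' : ∫ r in 0..v, (c - p y (y + r)) ≤ ε * v := by
    rw [intervalIntegral.integral_comp_add_left (fun r => c - p y r), add_zero,
      intervalIntegral.integral_sub intervalIntegrable_const (hp.intervalIntegrable_right _ _ _),
      intervalIntegral.integral_const, smul_eq_mul]
    have : ∫ t in y..(y + v), p y t = rightMean p y v * v := by
      rw [rightMean, div_mul_cancel₀ _ hv.ne']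
    rw [this]
    nlinarith
  have hB' : ∫ s in 0..u, (c - p (y - s) y) ≤ ε * u := by
    rw [intervalIntegral.integral_comp_sub_left (fun s => c - p s y), sub_zero,
      intervalIntegral.integral_sub intervalIntegrable_const (hp.intervalIntegrable_left _ _ _),
      intervalIntegral.integral_const, smul_eq_mul]
    have : ∫ t in (y - u)..y, p t y = rightMean (RandomHomeo.reflect p) (-y) u * u := by
      rw [rightMean, div_mul_cancel₀ _ hu.ne']
      simp only [RandomHomeo.reflect, neg_neg]
      rw [intervalIntegral.integral_comp_neg (fun t => p t y)]
      congr 1 <;> ring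
    rw [this]
    nlinarith
  set K := fun s r : ℝ => |p (y - s) (y + r) - c| with hK
  have Km : Measurable (Function.uncurry K) := by
    have := hp.measurable.comp (f := fun q : ℝ × ℝ => (y - q.1, y + q.2)) (by fun_prop)
    exact _root_.continuous_abs.measurable.comp (this.sub_const c)
  have Kb : ∀ s r, |K s r| ≤ 1 + 1 := fun s r => (abs_abs _).trans_le ((abs_sub _ _).trans
    (add_le_add (hp.abs_le_one _ _) (hp.abs_rightLimit_le_one _)))
  have Em := hp.measurable_mulDefect y
  have Eb : ∀ s r, |mulDefect p y s r| ≤ 1 := fun a b =>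
    (abs_abs _).trans_le (hp.mulDefect_le_one y a b)
  have section_int : ∀ {G : ℝ → ℝ → ℝ} {M : ℝ}, Measurable (Function.uncurry G) →
      (∀ s r, |G s r| ≤ M) → ∀ s, IntervalIntegrable (G s) volume 0 v :=
    fun hG hM s => intervalIntegrable_of_abs_le
      (hG.comp (measurable_const.prodMk measurable_id)) (hM s) _ _
  have mean_int : ∀ {G : ℝ → ℝ → ℝ} {M : ℝ}, Measurable (Function.uncurry G) →
      (∀ s r, |G s r| ≤ M) → IntervalIntegrable (fun s => ∫ r in 0..v, G s r) volume 0 u := by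
    intro G M hG hM
    refine intervalIntegrable_of_abs_le (M := M * |v - 0|) ?_ (fun s => ?_) _ _
    · simp_rw [intervalIntegral.integral_of_le hv.le]
      exact (hG.stronglyMeasurable.integral_prod_right (ν := volume.restrict (Ioc 0 v))).measurable
    · exact intervalIntegral.norm_integral_le_of_norm_le_const (f := G s) fun r _ => hM s r
  have iA : IntervalIntegrable (fun r => c - p y (y + r)) volume 0 v :=
    intervalIntegrable_of_abs_le (M := 1 + 1) (measurable_const.sub
      ((hp.measurable_right y).comp (measurable_const.add measurable_id)))
      (fun r => (abs_sub _ _).trans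
        (add_le_add (hp.abs_rightLimit_le_one _) (hp.abs_le_one _ _))) _ _
  have iB : IntervalIntegrable (fun s => c - p (y - s) y) volume 0 u :=
    intervalIntegrable_of_abs_le (M := 1 + 1) (measurable_const.sub
      ((hp.measurable_left y).comp (measurable_const.sub measurable_id)))
      (fun r => (abs_sub _ _).trans
        (add_le_add (hp.abs_rightLimit_le_one _) (hp.abs_le_one _ _))) _ _
  have inner : ∀ s ∈ Ioo 0 u, ∫ r in 0..v, mulDefect p y s r ≤
      (∫ r in 0..v, K s r) + (v * (c - p (y - s) y) + ε * v) := by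
    intro s hs
    have := intervalIntegral.integral_mono_on_of_le_Ioo hv.le (section_int Em Eb s)
      ((section_int Km Kb s).add ((intervalIntegrable_const (c := c - p (y - s) y)).add iA))
      fun r hr => hp.mulDefect_le hs.1 hr.1 hc hc' hcc
    rw [intervalIntegral.integral_add (section_int Km Kb s) (intervalIntegrable_const.add iA),
      intervalIntegral.integral_add intervalIntegrable_const iA, intervalIntegral.integral_const,
      smul_eq_mul] at this
    linarith
  have outer := intervalIntegral.integral_mono_on_of_le_Ioo hu.le (mean_int Em Eb)
    ((mean_int Km Kb).add ((iB.const_mul v).add (intervalIntegrable_const (c := ε * v)))) inner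
  rw [intervalIntegral.integral_add (mean_int Km Kb) ((iB.const_mul v).add intervalIntegrable_const),
    intervalIntegral.integral_add (iB.const_mul v) intervalIntegrable_const,
    intervalIntegral.integral_const_mul, intervalIntegral.integral_const, smul_eq_mul] at outer
  have h1 : ∫ s in 0..u, ∫ r in 0..v, K s r ≤ ε * u * v := H u v hu hu'.1 hv hv'.1
  have h2 := mul_le_mul_of_nonneg_left hB' hv.le
  linarith

/-- A self-averaging function of intervals is multiplicative at almost every division point. -/
theorem ae_eq_mul : ∀ᵐ y, ∀ x z, x < y → y < z → p x z = p x y * p y z := by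
  filter_upwards [hp.ae_mulDefect_eq_zero] with y hy x z hxy hyz
  have := hy (y - x) (z - y) (sub_pos.2 hxy) (sub_pos.2 hyz)
  rw [mulDefect, sub_sub_cancel, add_sub_cancel, abs_eq_zero] at this
  exact sub_eq_zero.1 this

end IsSelfAveraging

end Multiplicativity

/-! ### From Lebesgue measurable solutions on the triangle to Borel solutions -/

section Triangle

theorem measurableSet_triangle : MeasurableSet triangle := by
  have h : IsClosed triangle :=
    (isClosed_le continuous_const continuous_fst).inter
      ((isClosed_le continuous_fst continuous_snd).inter
        (isClosed_le continuous_snd continuous_const))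
  exact h.measurableSet

/-- A solution of the averaging equation on the triangle agrees on `G × G`, for a set `G` of full
measure, with a Borel solution on the plane. -/
theorem exists_isSelfAveraging {p : ℝ → ℝ → ℝ}
    (hm : AEMeasurable (fun q : ℝ × ℝ => p q.1 q.2) (volume.restrict triangle))
    (hp : ∀ x y : ℝ, 0 ≤ x → x ≤ y → y ≤ 1 → 0 ≤ p x y ∧ p x y ≤ 1)
    (heq : ∀ x y : ℝ, 0 ≤ x → x < y → y ≤ 1 →
      p x y = 1 / (y - x) * ∫ t in x..y, p x t * p t y) :
    ∃ (G : Set ℝ) (p' : ℝ → ℝ → ℝ), (∀ᵐ x, x ∈ Icc (0 : ℝ) 1 → x ∈ G) ∧ IsSelfAveraging p' ∧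
      ∀ x ∈ G, ∀ y ∈ G, x < y → p' x y = p x y := by
  set q₀ : ℝ × ℝ → ℝ := fun q => max 0 (min 1 (hm.mk _ q)) with hq₀
  have hq₀m : Measurable q₀ := measurable_const.max (measurable_const.min hm.measurable_mk)
  have hq₀0 : ∀ q, 0 ≤ q₀ q := fun q => le_max_left _ _
  have hq₀1 : ∀ q, q₀ q ≤ 1 := fun q => max_le zero_le_one (min_le_left _ _)
  have hae : ∀ᵐ q : ℝ × ℝ, q ∈ triangle → p q.1 q.2 = q₀ q := by
    rw [← ae_restrict_iff' measurableSet_triangle]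
    filter_upwards [hm.ae_eq_mk, ae_restrict_mem measurableSet_triangle] with q hq hqt
    obtain ⟨h0, h1⟩ := hp q.1 q.2 hqt.1 hqt.2.1 hqt.2.2
    simp only [hq₀]
    rw [← hq, min_eq_right h1, max_eq_right h0]
  rw [Measure.volume_eq_prod] at hae
  have h1 := Measure.ae_ae_of_ae_prod hae
  have h2 := Measure.ae_ae_of_ae_prod
    ((Measure.measurePreserving_swap (μ := (volume : Measure ℝ))
      (ν := (volume : Measure ℝ))).quasiMeasurePreserving.ae hae)
  -- Points over which the horizontal and the vertical section of `p` both agree almost everywhere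
  -- with the Borel representative `q₀`.
  obtain ⟨G₁, hG₁, hG₁m, hG₁'⟩ := (h1.and h2).exists_measurable_mem
  have hGm : MeasurableSet (G₁ ∩ Icc (0 : ℝ) 1) := hG₁m.inter measurableSet_Icc
  set G := G₁ ∩ Icc (0 : ℝ) 1 with hG
  have hGae : ∀ᵐ x, x ∈ Icc (0 : ℝ) 1 → x ∈ G := by
    filter_upwards [hG₁] with x hx hx' using ⟨hx, hx'⟩
  -- Rescaling `[x, y]` to `[0, 1]` turns the mean into a parameter integral, measurable in `(x,
  -- y)`.
  set F : ℝ × ℝ → ℝ → ℝ := fun q s =>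
    q₀ (q.1, q.1 + (q.2 - q.1) * s) * q₀ (q.1 + (q.2 - q.1) * s, q.2) with hF
  have hFm : Measurable (Function.uncurry F) := by
    have m1 := hq₀m.comp (f := fun r : (ℝ × ℝ) × ℝ =>
      (r.1.1, r.1.1 + (r.1.2 - r.1.1) * r.2)) (by fun_prop)
    have m2 := hq₀m.comp (f := fun r : (ℝ × ℝ) × ℝ =>
      (r.1.1 + (r.1.2 - r.1.1) * r.2, r.1.2)) (by fun_prop)
    exact m1.mul m2
  have hF0 : ∀ q s, 0 ≤ F q s := fun q s => mul_nonneg (hq₀0 _) (hq₀0 _)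
  have hF1 : ∀ q s, F q s ≤ 1 := fun q s => mul_le_one₀ (hq₀1 _) (hq₀0 _) (hq₀1 _)
  set S : Set (ℝ × ℝ) := {q | q.1 ∈ G ∧ q.2 ∈ G ∧ q.1 < q.2} with hS
  have hSm : MeasurableSet S := (measurable_fst hGm).inter
    ((measurable_snd hGm).inter (measurableSet_lt measurable_fst measurable_snd))
  -- The equation holds for every pair, so one averaging of `q₀` recovers `p` exactly on pairs `x <
  -- y` from `G`. The value `0` elsewhere preserves the equation: if an endpoint is outside `G`,
  -- both sides vanish.
  set P : ℝ × ℝ → ℝ := S.indicator fun q => ∫ s in 0..1, F q s with hP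
  have hPm : Measurable P := by
    refine Measurable.indicator ?_ hSm
    simp_rw [intervalIntegral.integral_of_le (zero_le_one' ℝ)]
    exact (hFm.stronglyMeasurable.integral_prod_right (ν := volume.restrict (Ioc 0 1))).measurable
  have agree : ∀ x ∈ G, ∀ y ∈ G, x < y → P (x, y) = p x y := by
    intro x hx y hy hxy
    have hxy' : y - x ≠ 0 := by linarith
    have hmem : (x, y) ∈ S := ⟨hx, hy, hxy⟩
    rw [hP, indicator_of_mem hmem, heq x y hx.2.1 hxy hy.2.2, one_div]
    have e := intervalIntegral.integral_comp_add_mul (a := 0) (b := 1)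
      (fun t => q₀ (x, t) * q₀ (t, y)) hxy' x
    rw [mul_zero, add_zero, mul_one, add_sub_cancel, smul_eq_mul] at e
    refine e.trans ?_
    congr 1
    refine intervalIntegral.integral_congr_ae ?_
    filter_upwards [(hG₁' x hx.1).1, (hG₁' y hy.1).2] with t ht1 ht2 ht
    rw [uIoc_of_le hxy.le] at ht
    have ht1' := ht1 ⟨hx.2.1, ht.1.le, ht.2.trans hy.2.2⟩
    have ht2' := ht2 ⟨hx.2.1.trans ht.1.le, ht.2, hy.2.2⟩
    simp only [Prod.swap] at ht1' ht2'
    rw [ht1', ht2']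
  have zero : ∀ x y, (x ∉ G ∨ y ∉ G) → P (x, y) = 0 := by
    intro x y h
    refine indicator_of_notMem (fun hmem => ?_) _
    rcases h with h | h
    · exact h hmem.1
    · exact h hmem.2.1
  refine ⟨G, fun x y => P (x, y), hGae, ⟨hPm, fun x y => ?_, fun x y => ?_, fun x y hxy => ?_⟩, agree⟩
  · exact indicator_nonneg
      (fun q _ => intervalIntegral.integral_nonneg zero_le_one fun s _ => hF0 q s) _
  · refine indicator_apply_le' (fun _ => ?_) fun _ => zero_le_one
    have := intervalIntegral_le_mul (zero_le_one' ℝ) (F := F (x, y)) (C := 1)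
      (intervalIntegrable_of_abs_le (F := F (x, y)) (M := 1) (hFm.comp (measurable_const.prodMk measurable_id))
        (fun s => abs_le.2 ⟨by linarith [hF0 (x, y) s], hF1 _ _⟩) 0 1) fun s _ => hF1 _ s
    simpa using this
  · by_cases hx : x ∈ G
    · by_cases hy : y ∈ G
      · rw [agree x hx y hy hxy, heq x y hx.2.1 hxy hy.2.2, ← mul_assoc,
          mul_one_div_cancel (by linarith), one_mul]
        refine intervalIntegral.integral_congr_ae ?_
        have hne : ∀ᵐ t : ℝ, t ≠ y := by simp [ae_iff]
        filter_upwards [hGae, hne] with t ht hty hxt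
        rw [uIoc_of_le hxy.le] at hxt
        have htG : t ∈ G := ht ⟨hx.2.1.trans hxt.1.le, hxt.2.trans hy.2.2⟩
        rw [agree x hx t htG hxt.1, agree t htG y hy (lt_of_le_of_ne hxt.2 hty)]
      · rw [zero x y (Or.inr hy)]
        simp [zero _ y (Or.inr hy)]
    · rw [zero x y (Or.inl hx)]
      simp [zero x _ (Or.inl hx)]

theorem ae_eq_mul_of_eq_integral {p : ℝ → ℝ → ℝ}
    (hm : AEMeasurable (fun q : ℝ × ℝ => p q.1 q.2) (volume.restrict triangle))
    (hp : ∀ x y : ℝ, 0 ≤ x → x ≤ y → y ≤ 1 → 0 ≤ p x y ∧ p x y ≤ 1)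
    (heq : ∀ x y : ℝ, 0 ≤ x → x < y → y ≤ 1 →
      p x y = 1 / (y - x) * ∫ t in x..y, p x t * p t y) :
    ∀ᵐ q : ℝ × ℝ × ℝ, 0 ≤ q.1 → q.1 < q.2.1 → q.2.1 < q.2.2 → q.2.2 ≤ 1 →
      p q.1 q.2.2 ≤ p q.1 q.2.1 ∧ p q.1 q.2.2 ≤ p q.2.1 q.2.2 ∧
        p q.1 q.2.2 = p q.1 q.2.1 * p q.2.1 q.2.2 := by
  obtain ⟨G, p', hG, hp', agree⟩ := exists_isSelfAveraging hm hp heq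
  rw [Measure.volume_eq_prod, Measure.volume_eq_prod]
  have h1 := (Measure.quasiMeasurePreserving_fst (μ := (volume : Measure ℝ))
    (ν := (volume : Measure ℝ).prod (volume : Measure ℝ))).ae hG
  have q2 := Measure.quasiMeasurePreserving_snd (μ := (volume : Measure ℝ))
    (ν := (volume : Measure ℝ).prod (volume : Measure ℝ))
  -- Multiplicativity restricts the division point alone; the outer points need only lie in `G`,
  -- where `p'` agrees with `p`.
  have h2 := q2.ae ((Measure.quasiMeasurePreserving_fst (μ := (volume : Measure ℝ))
    (ν := (volume : Measure ℝ))).ae (hG.and hp'.ae_eq_mul))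
  have h3 := q2.ae ((Measure.quasiMeasurePreserving_snd (μ := (volume : Measure ℝ))
    (ν := (volume : Measure ℝ))).ae hG)
  filter_upwards [h1, h2, h3] with ⟨x, y, z⟩ h1 h2 h3 hx hxy hyz hz
  dsimp only at *
  have hxG := h1 ⟨hx, by linarith⟩
  have hyG := h2.1 ⟨by linarith, by linarith⟩
  have hzG := h3 ⟨by linarith, hz⟩
  have e := h2.2 x z hxy hyz
  rw [agree x hxG z hzG (hxy.trans hyz), agree x hxG y hyG hxy, agree y hyG z hzG hyz] at e
  obtain ⟨a0, a1⟩ := hp x y hx hxy.le (by linarith)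
  obtain ⟨b0, b1⟩ := hp y z (by linarith) hyz.le hz
  exact ⟨e ▸ mul_le_of_le_one_right a0 b1, e ▸ mul_le_of_le_one_left b0 a1, e⟩

end Triangle

/-! ### The binary tree of ratios and the self-similarity of its law -/

section Nodes

/-- The index set of the random variables used by `dyadicValue`: the nodes `(n, k)`, `k` odd,
`k < 2 ^ n`, of an infinite binary tree. -/
abbrev Node : Type := {q : ℕ × ℕ // Odd q.2 ∧ q.2 < 2 ^ q.1}

namespace Node

/-- The root `(1, 1)`, which corresponds to the point `1 / 2`. -/
def root : Node := ⟨(1, 1), odd_one, by norm_num⟩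

/-- The node corresponding to `j` in the left half of the tree. -/
def left (j : Node) : Node :=
  ⟨(j.1.1 + 1, j.1.2), j.2.1, j.2.2.trans (Nat.pow_lt_pow_succ one_lt_two)⟩

theorem level_pos (j : Node) : 0 < j.1.1 := by
  obtain ⟨⟨n, k⟩, hk, hkn⟩ := j
  rcases Nat.eq_zero_or_pos n with rfl | h
  · have : k = 0 := by simpa using hkn
    exact absurd hk (by simp [this])
  · exact h

/-- The node corresponding to `j` in the right half of the tree. -/
def right (j : Node) : Node :=
  ⟨(j.1.1 + 1, 2 ^ j.1.1 + j.1.2),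
    (Even.pow_of_ne_zero even_two j.level_pos.ne').add_odd j.2.1, by
      have := j.2.2
      rw [pow_succ]
      dsimp only
      omega⟩

/-- The tree consists of its root and its two halves. -/
def ofSum : Unit ⊕ (Node ⊕ Node) → Node
  | Sum.inl _ => root
  | Sum.inr (Sum.inl j) => left j
  | Sum.inr (Sum.inr j) => right j

theorem eq_root_or (j : Node) : j = root ∨ (∃ i, j = left i) ∨ ∃ i, j = right i := by
  obtain ⟨⟨n, k⟩, hk, hkn⟩ := j
  have hn : 0 < n := level_pos ⟨⟨n, k⟩, hk, hkn⟩
  obtain ⟨m, rfl⟩ : ∃ m, n = m + 1 := ⟨n - 1, by omega⟩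
  dsimp only at hk hkn
  rcases lt_trichotomy k (2 ^ m) with h | h | h
  · exact Or.inr (Or.inl ⟨⟨(m, k), hk, h⟩, rfl⟩)
  -- The index `2 ^ m` is odd only for `m = 0`, which is the root.
  · rcases Nat.eq_zero_or_pos m with rfl | hm
    · exact Or.inl (Subtype.ext (by simp [root, h]))
    · have : Even k := h ▸ Even.pow_of_ne_zero even_two hm.ne'
      exact absurd this (Nat.not_even_iff_odd.2 hk)
  · have hm : m ≠ 0 := by
      rintro rfl
      simp at h hkn
      omega
    refine Or.inr (Or.inr ⟨⟨(m, k - 2 ^ m), ?_, ?_⟩, Subtype.ext ?_⟩)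
    · exact Nat.Odd.sub_even h.le hk (Even.pow_of_ne_zero even_two hm)
    · dsimp only
      rw [pow_succ] at hkn
      omega
    · simp only [right]
      rw [Nat.add_sub_cancel' h.le]

theorem ofSum_bijective : Function.Bijective ofSum := by
  constructor
  · rintro (u | i | i) (v | j | j) h
    · rfl
    · have := congrArg (fun q : Node => q.1.1) h
      have := j.level_pos
      simp [ofSum, left, root] at *
      omega
    · have := congrArg (fun q : Node => q.1.1) h
      have := j.level_pos
      simp [ofSum, right, root] at *
      omega
    · have := congrArg (fun q : Node => q.1.1) h
      have := i.level_pos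
      simp [ofSum, left, root] at *
      omega
    · have h1 := congrArg (fun q : Node => q.1.1) h
      have h2 := congrArg (fun q : Node => q.1.2) h
      simp only [ofSum, left, Nat.add_right_cancel_iff] at h1 h2
      rw [Subtype.ext (Prod.ext h1 h2)]
    · have h1 := congrArg (fun q : Node => q.1.1) h
      have h2 := congrArg (fun q : Node => q.1.2) h
      simp only [ofSum, left, right, Nat.add_right_cancel_iff] at h1 h2
      have := i.2.2
      rw [h1] at this
      omega
    · have := congrArg (fun q : Node => q.1.1) h
      have := i.level_pos
      simp [ofSum, right, root] at *
      omega
    · have h1 := congrArg (fun q : Node => q.1.1) h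
      have h2 := congrArg (fun q : Node => q.1.2) h
      simp only [ofSum, left, right, Nat.add_right_cancel_iff] at h1 h2
      have := j.2.2
      rw [← h1] at this
      omega
    · have h1 := congrArg (fun q : Node => q.1.1) h
      have h2 := congrArg (fun q : Node => q.1.2) h
      simp only [ofSum, right, Nat.add_right_cancel_iff] at h1 h2
      rw [h1, Nat.add_left_cancel_iff] at h2
      rw [Subtype.ext (Prod.ext h1 h2)]
  · intro j
    rcases eq_root_or j with rfl | ⟨i, rfl⟩ | ⟨i, rfl⟩
    · exact ⟨Sum.inl (), rfl⟩
    · exact ⟨Sum.inr (Sum.inl i), rfl⟩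
    · exact ⟨Sum.inr (Sum.inr i), rfl⟩

/-- The tree as the disjoint union of its root and its two halves. -/
noncomputable def sumEquiv : Unit ⊕ (Node ⊕ Node) ≃ Node := Equiv.ofBijective ofSum ofSum_bijective

end Node

/-- The uniform distribution on `[0,1]`. -/
noncomputable def unif : Measure ℝ := volume.restrict (Icc 0 1)

instance : IsProbabilityMeasure unif := ⟨by simp [unif]⟩

/-- The joint distribution of independent uniform variables indexed by the nodes. -/
noncomputable def nodeLaw : Measure (Node → ℝ) := Measure.infinitePi fun _ => unif

instance : IsProbabilityMeasure nodeLaw := by unfold nodeLaw; infer_instance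

/-- The value at the root, and the values in the two halves of the tree. -/
def split (w : Node → ℝ) : ℝ × (Node → ℝ) × (Node → ℝ) :=
  (w Node.root, fun j => w j.left, fun j => w j.right)

/-- The inverse of `split`. -/
noncomputable def glue (q : ℝ × (Node → ℝ) × (Node → ℝ)) (j : Node) : ℝ :=
  Sum.elim (fun _ => q.1) (Sum.elim q.2.1 q.2.2) (Node.sumEquiv.symm j)

theorem glue_ofSum (q : ℝ × (Node → ℝ) × (Node → ℝ)) (i : Unit ⊕ (Node ⊕ Node)) :
    glue q (Node.ofSum i) = Sum.elim (fun _ => q.1) (Sum.elim q.2.1 q.2.2) i := by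
  have : Node.ofSum i = Node.sumEquiv i := rfl
  rw [glue, this, Equiv.symm_apply_apply]

theorem split_glue (q : ℝ × (Node → ℝ) × (Node → ℝ)) : split (glue q) = q := by
  obtain ⟨u, a, b⟩ := q
  refine Prod.ext (glue_ofSum _ (Sum.inl ())) (Prod.ext (funext fun j => ?_) (funext fun j => ?_))
  · exact glue_ofSum _ (Sum.inr (Sum.inl j))
  · exact glue_ofSum _ (Sum.inr (Sum.inr j))

theorem measurable_split : Measurable split := by
  unfold split
  fun_prop

theorem measurable_glue : Measurable glue := by
  refine measurable_pi_lambda _ fun j => ?_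
  obtain ⟨i, rfl⟩ := Node.ofSum_bijective.2 j
  simp_rw [glue_ofSum]
  rcases i with u | i | i
  · exact measurable_fst
  · exact (measurable_pi_apply i).comp (measurable_fst.comp measurable_snd)
  · exact (measurable_pi_apply i).comp (measurable_snd.comp measurable_snd)

/-- An infinite product law is determined by finite boxes, and the preimage of such a box under
`glue` is a product of a root condition and two boxes in the halves. -/
theorem map_glue : (unif.prod (nodeLaw.prod nodeLaw)).map glue = nodeLaw := by
  refine Measure.eq_infinitePi _ fun s t ht => ?_
  set s' : Finset (Unit ⊕ (Node ⊕ Node)) := s.map Node.sumEquiv.symm.toEmbedding with hs'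
  have hprod : ∏ i ∈ s, unif (t i) = ∏ i ∈ s', unif (t (Node.ofSum i)) := by
    rw [hs', Finset.prod_map]
    refine Finset.prod_congr rfl fun i _ => ?_
    change _ = unif (t (Node.sumEquiv (Node.sumEquiv.symm i)))
    rw [Equiv.apply_symm_apply]
  have hpre : glue ⁻¹' (Set.pi s t) = {u | ∀ i ∈ s'.toLeft, u ∈ t (Node.ofSum (Sum.inl i))} ×ˢ
      (Set.pi s'.toRight.toLeft (fun i => t i.left) ×ˢ
        Set.pi s'.toRight.toRight fun i => t i.right) := by
    ext q
    have h1 : q ∈ glue ⁻¹' (Set.pi s t) ↔ ∀ i ∈ s', glue q (Node.ofSum i) ∈ t (Node.ofSum i) := by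
      simp only [mem_preimage, Set.mem_pi, hs', Finset.mem_coe, Finset.mem_map]
      constructor
      · rintro h _ ⟨j, hj, rfl⟩
        have e : Node.ofSum (Node.sumEquiv.symm.toEmbedding j) = j :=
          Equiv.apply_symm_apply Node.sumEquiv j
        rw [e]
        exact h j hj
      · intro h j hj
        have := h _ ⟨j, hj, rfl⟩
        have e : Node.ofSum (Node.sumEquiv.symm.toEmbedding j) = j :=
          Equiv.apply_symm_apply Node.sumEquiv j
        rwa [e] at this
    rw [h1]
    simp only [glue_ofSum, Sum.forall, mem_prod, Set.mem_pi, Finset.mem_coe,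
      Finset.mem_toLeft, Finset.mem_toRight, mem_ofPred_eq]
    rfl
  have hpi : ∀ (s : Finset Node) (t : Node → Set ℝ), (∀ i, MeasurableSet (t i)) →
      nodeLaw (Set.pi s t) = ∏ i ∈ s, unif (t i) := fun s t ht =>
    Measure.infinitePi_pi _ fun i _ => ht i
  -- The root contributes one factor, or none when the box does not restrict it.
  have hunit : unif {u | ∀ i ∈ s'.toLeft, u ∈ t (Node.ofSum (Sum.inl i))} =
      ∏ i ∈ s'.toLeft, unif (t (Node.ofSum (Sum.inl i))) := by
    by_cases h : () ∈ s'.toLeft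
    · have : s'.toLeft = {()} := by
        ext u
        simpa using h
      rw [this, Finset.prod_singleton]
      congr 1
      ext u
      simp only [Finset.mem_singleton, mem_ofPred_eq, forall_const]
      exact ⟨fun h => h (), fun h _ => h⟩
    · have : s'.toLeft = ∅ := by
        ext u
        simpa using h
      rw [this]
      simp
  rw [Measure.map_apply measurable_glue (MeasurableSet.pi s.countable_toSet fun i _ => ht i), hpre,
    Measure.prod_prod, Measure.prod_prod, hunit, hpi _ _ fun i => ht _, hpi _ _ fun i => ht _, hprod,
    Finset.prod_sum_eq_prod_toLeft_mul_prod_toRight,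
    Finset.prod_sum_eq_prod_toLeft_mul_prod_toRight]
  rfl

theorem measurePreserving_split :
    MeasurePreserving split nodeLaw (unif.prod (nodeLaw.prod nodeLaw)) := by
  refine ⟨measurable_split, ?_⟩
  conv_lhs => rw [← map_glue]
  rw [Measure.map_map measurable_split measurable_glue,
    show split ∘ glue = id from funext split_glue, Measure.map_id]

/-- Reduces all probabilistic statements to the canonical space `Node → ℝ`. -/
theorem map_eq_nodeLaw {Ω : Type*} [MeasurableSpace Ω] {P : Measure Ω} [IsProbabilityMeasure P]
    {X : ℕ → ℕ → Ω → ℝ} (hX : IsUniformFamily P X) :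
    MeasurePreserving (fun ω (j : Node) => X j.1.1 j.1.2 ω) P nodeLaw := by
  have hm : ∀ j : Node, Measurable (X j.1.1 j.1.2) := fun j => hX.measurable _ _ j.2.1 j.2.2
  refine ⟨measurable_pi_lambda _ hm, ?_⟩
  have := hX.indep.map_fun_eq_infinitePi_map hm
  rw [this, nodeLaw]
  congr 1
  funext j
  have h := hX.uniform _ _ j.2.1 j.2.2
  rw [pdf.IsUniform, ProbabilityTheory.cond] at h
  rw [h, unif]
  simp

end Nodes

/-! ### Recursion for the dyadic values -/

section DyadicValues

variable {ξ ξ' : ℕ → ℕ → ℝ}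

theorem dyadicValue_even (ξ : ℕ → ℕ → ℝ) (n k : ℕ) :
    dyadicValue ξ (n + 1) (2 * k) = dyadicValue ξ n k := by
  rw [dyadicValue, if_pos (even_two_mul k), Nat.mul_div_cancel_left _ two_pos]

theorem dyadicValue_odd (ξ : ℕ → ℕ → ℝ) (n k : ℕ) :
    dyadicValue ξ (n + 1) (2 * k + 1) = dyadicValue ξ n k +
      ξ (n + 1) (2 * k + 1) * (dyadicValue ξ n (k + 1) - dyadicValue ξ n k) := by
  rw [dyadicValue, if_neg (by simp [parity_simps])]
  have : (2 * k + 1) / 2 = k := by omega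
  rw [this]

theorem dyadicValue_zero (ξ : ℕ → ℕ → ℝ) (n : ℕ) : dyadicValue ξ n 0 = 0 := by
  induction n with
  | zero => simp [dyadicValue]
  | succ n ih => simpa using (dyadicValue_even ξ n 0).trans ih

theorem dyadicValue_mul_two_pow (ξ : ℕ → ℕ → ℝ) (n m k : ℕ) :
    dyadicValue ξ (n + m) (2 ^ m * k) = dyadicValue ξ n k := by
  induction m with
  | zero => simp
  | succ m ih => rw [← add_assoc, pow_succ', mul_assoc, dyadicValue_even, ih]

theorem dyadicValue_two_pow (ξ : ℕ → ℕ → ℝ) (n : ℕ) : dyadicValue ξ n (2 ^ n) = 1 := by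
  have := dyadicValue_mul_two_pow ξ 0 n 1
  simpa [dyadicValue] using this

theorem dyadicValue_congr (h : ∀ n k, Odd k → k < 2 ^ n → ξ n k = ξ' n k) (n : ℕ) :
    ∀ k ≤ 2 ^ n, dyadicValue ξ n k = dyadicValue ξ' n k := by
  induction n with
  | zero => intro k _; rfl
  | succ n ih =>
    intro k hk
    rw [pow_succ] at hk
    rcases Nat.even_or_odd' k with ⟨m, rfl | rfl⟩
    · rw [dyadicValue_even, dyadicValue_even, ih m (by omega)]
    · rw [dyadicValue_odd, dyadicValue_odd, ih m (by omega), ih (m + 1) (by omega),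
        h _ _ (odd_two_mul_add_one m) (by rw [pow_succ]; omega)]

/-- The recursion is affine in the two neighbouring values, so each half of the dyadic function is
an affine copy of the one built from the corresponding half of the tree. `dyadicValue_right` is the
other half. -/
theorem dyadicValue_left (ξ : ℕ → ℕ → ℝ) (n : ℕ) : ∀ k ≤ 2 ^ n,
    dyadicValue ξ (n + 1) k = ξ 1 1 * dyadicValue (fun n k => ξ (n + 1) k) n k := by
  induction n with
  | zero =>
    intro k hk
    have : k = 0 ∨ k = 1 := by simp at hk; omega
    rcases this with rfl | rfl
    · simp [dyadicValue_zero]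
    · simp [dyadicValue]
  | succ n ih =>
    intro k hk
    rw [pow_succ] at hk
    rcases Nat.even_or_odd' k with ⟨m, rfl | rfl⟩
    · rw [dyadicValue_even, dyadicValue_even, ih m (by omega)]
    · rw [dyadicValue_odd, dyadicValue_odd, ih m (by omega), ih (m + 1) (by omega)]
      ring

theorem dyadicValue_right (ξ : ℕ → ℕ → ℝ) (n : ℕ) : ∀ k ≤ 2 ^ n,
    dyadicValue ξ (n + 1) (2 ^ n + k) =
      ξ 1 1 + (1 - ξ 1 1) * dyadicValue (fun n k => ξ (n + 1) (2 ^ n + k)) n k := by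
  induction n with
  | zero =>
    intro k hk
    have : k = 0 ∨ k = 1 := by simp at hk; omega
    rcases this with rfl | rfl
    · simp [dyadicValue]
    · simp [dyadicValue]
  | succ n ih =>
    intro k hk
    rw [pow_succ] at hk
    rcases Nat.even_or_odd' k with ⟨m, rfl | rfl⟩
    · rw [pow_succ', ← mul_add, dyadicValue_even, dyadicValue_even, ih m (by omega)]
    · rw [pow_succ', ← add_assoc, ← mul_add, dyadicValue_odd, dyadicValue_odd, ih m (by omega),
        add_assoc (2 ^ n) m 1, ih (m + 1) (by omega)]
      rw [show 2 * (2 ^ n + m) + 1 = 2 ^ (n + 1) + (2 * m + 1) by rw [pow_succ']; ring]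
      ring

end DyadicValues

/-! ### The homeomorphism determined by given ratios -/

section Homeomorphism

variable {ξ : ℕ → ℕ → ℝ}

/-- All division ratios lie strictly between `0` and `1`. -/
def IsNondegenerate (ξ : ℕ → ℕ → ℝ) : Prop :=
  ∀ n k, Odd k → k < 2 ^ n → ξ n k ∈ Ioo (0 : ℝ) 1

/-- The sum of the squares of the lengths of the intervals of generation `n`. -/
noncomputable def gapSum (ξ : ℕ → ℕ → ℝ) (n : ℕ) : ℝ :=
  ∑ k ∈ Finset.range (2 ^ n), (dyadicValue ξ n (k + 1) - dyadicValue ξ n k) ^ 2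

/-- The limit of the values at dyadic points increasing to `x`. -/
noncomputable def dyadicLimit (ξ : ℕ → ℕ → ℝ) (x : ℝ) : ℝ :=
  ⨆ n : ℕ, dyadicValue ξ n ⌊x * 2 ^ n⌋₊

theorem floor_mul_two_pow_le {x : ℝ} (hx : x ≤ 1) (n : ℕ) : ⌊x * 2 ^ n⌋₊ ≤ 2 ^ n := by
  refine Nat.floor_le_of_le ?_
  push_cast
  exact mul_le_of_le_one_left (by positivity) hx

theorem floor_mul_two_pow_div_le {x : ℝ} (hx : 0 ≤ x) (n : ℕ) :
    (⌊x * 2 ^ n⌋₊ : ℝ) / 2 ^ n ≤ x := by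
  rw [div_le_iff₀ (by positivity)]
  exact Nat.floor_le (by positivity)

theorem tendsto_floor_mul_two_pow_div {x : ℝ} (hx : 0 ≤ x) :
    Tendsto (fun n : ℕ => (⌊x * 2 ^ n⌋₊ : ℝ) / 2 ^ n) atTop (𝓝 x) :=
  (tendsto_nat_floor_mul_div_atTop hx).comp (tendsto_pow_atTop_atTop_of_one_lt one_lt_two)

theorem Extends.apply_floor {φ : I ≃o I} (hφ : Extends ξ φ) (x : I) :
    ∃ a : ℕ → I, Tendsto a atTop (𝓝 x) ∧ (∀ n, a n ≤ x) ∧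
      ∀ n, ((φ (a n) : I) : ℝ) = dyadicValue ξ n ⌊(x : ℝ) * 2 ^ n⌋₊ := by
  have hmem : ∀ n : ℕ, (⌊(x : ℝ) * 2 ^ n⌋₊ : ℝ) / 2 ^ n ∈ I := fun n =>
    ⟨by positivity, (floor_mul_two_pow_div_le x.2.1 n).trans x.2.2⟩
  exact ⟨fun n => ⟨_, hmem n⟩, tendsto_subtype_rng.2 (tendsto_floor_mul_two_pow_div x.2.1),
    fun n => floor_mul_two_pow_div_le x.2.1 n, fun n => hφ ⟨_, hmem n⟩ n _ rfl⟩

theorem Extends.tendsto {φ : I ≃o I} (hφ : Extends ξ φ) (x : I) :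
    Tendsto (fun n : ℕ => dyadicValue ξ n ⌊(x : ℝ) * 2 ^ n⌋₊) atTop (𝓝 (φ x : I)) := by
  obtain ⟨a, ha, -, hav⟩ := hφ.apply_floor x
  simp_rw [← hav]
  exact (continuous_subtype_val.tendsto _).comp ((φ.continuous.tendsto x).comp ha)

/-- Values at dyadic points below `x` stay below `φ x` and converge to it by continuity. The formula
yields both uniqueness and joint measurability of `φ`. -/
theorem Extends.eq_dyadicLimit {φ : I ≃o I} (hφ : Extends ξ φ) (x : I) :
    ((φ x : I) : ℝ) = dyadicLimit ξ x := by
  obtain ⟨a, -, hax, hav⟩ := hφ.apply_floor x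
  have hle : ∀ n, dyadicValue ξ n ⌊(x : ℝ) * 2 ^ n⌋₊ ≤ φ x := by
    intro n
    rw [← hav]
    exact φ.monotone (hax n)
  exact le_antisymm (le_of_tendsto' (hφ.tendsto x) fun n =>
    le_ciSup (f := fun n : ℕ => dyadicValue ξ n ⌊(x : ℝ) * 2 ^ n⌋₊)
      ⟨_, forall_mem_range.2 hle⟩ n) (ciSup_le hle)

theorem Extends.unique {φ φ' : I ≃o I} (h : Extends ξ φ) (h' : Extends ξ φ') : φ = φ' := by
  ext x
  rw [h.eq_dyadicLimit, h'.eq_dyadicLimit]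

theorem Extends.congr {ξ' : ℕ → ℕ → ℝ} {φ : I ≃o I}
    (h : ∀ n k, Odd k → k < 2 ^ n → ξ n k = ξ' n k) (hφ : Extends ξ φ) : Extends ξ' φ := by
  intro x n k hx
  rw [hφ x n k hx]
  refine dyadicValue_congr h n k ?_
  have h1 : (k : ℝ) / 2 ^ n ≤ 1 := hx ▸ x.2.2
  rw [div_le_one (by positivity)] at h1
  exact_mod_cast h1

theorem IsNondegenerate.lt_succ (h : IsNondegenerate ξ) (n : ℕ) :
    ∀ k < 2 ^ n, dyadicValue ξ n k < dyadicValue ξ n (k + 1) := by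
  induction n with
  | zero =>
    intro k hk
    have : k = 0 := by simpa using hk
    simp [this, dyadicValue]
  | succ n ih =>
    intro k hk
    rw [pow_succ] at hk
    rcases Nat.even_or_odd' k with ⟨m, rfl | rfl⟩
    · have h1 := ih m (by omega)
      obtain ⟨h2, h3⟩ := h (n + 1) (2 * m + 1) (odd_two_mul_add_one m) (by rw [pow_succ]; omega)
      rw [dyadicValue_even, dyadicValue_odd]
      nlinarith
    · have h1 := ih m (by omega)
      obtain ⟨h2, h3⟩ := h (n + 1) (2 * m + 1) (odd_two_mul_add_one m) (by rw [pow_succ]; omega)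
      rw [show 2 * m + 1 + 1 = 2 * (m + 1) by ring, dyadicValue_even, dyadicValue_odd]
      nlinarith

theorem IsNondegenerate.strictMonoOn (h : IsNondegenerate ξ) (n : ℕ) {j k : ℕ} (hjk : j < k)
    (hk : k ≤ 2 ^ n) : dyadicValue ξ n j < dyadicValue ξ n k := by
  induction k, hjk using Nat.le_induction with
  | base => exact h.lt_succ n j (by omega)
  | succ k hjk ih => exact (ih (by omega)).trans (h.lt_succ n k (by omega))

theorem IsNondegenerate.monotoneOn (h : IsNondegenerate ξ) (n : ℕ) {j k : ℕ} (hjk : j ≤ k)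
    (hk : k ≤ 2 ^ n) : dyadicValue ξ n j ≤ dyadicValue ξ n k := by
  rcases hjk.eq_or_lt with rfl | hjk
  · exact le_rfl
  · exact (h.strictMonoOn n hjk hk).le

theorem IsNondegenerate.dyadicValue_mono (h : IsNondegenerate ξ) {n m a b : ℕ} (hb : b ≤ 2 ^ m)
    (hab : (a : ℝ) / 2 ^ n ≤ (b : ℝ) / 2 ^ m) : dyadicValue ξ n a ≤ dyadicValue ξ m b := by
  rw [← dyadicValue_mul_two_pow ξ n m a, ← dyadicValue_mul_two_pow ξ m n b, add_comm m n]
  refine h.monotoneOn _ ?_ ?_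
  · rw [div_le_div_iff₀ (by positivity) (by positivity)] at hab
    have : a * 2 ^ m ≤ b * 2 ^ n := by exact_mod_cast hab
    rwa [mul_comm, mul_comm _ b]
  · rw [pow_add]
    exact Nat.mul_le_mul_left _ hb

theorem IsNondegenerate.dyadicValue_mem (h : IsNondegenerate ξ) {n k : ℕ} (hk : k ≤ 2 ^ n) :
    dyadicValue ξ n k ∈ I :=
  ⟨(dyadicValue_zero ξ n).symm.trans_le (h.monotoneOn n k.zero_le hk),
    (h.monotoneOn n hk le_rfl).trans_eq (dyadicValue_two_pow ξ n)⟩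

theorem IsNondegenerate.bddAbove (h : IsNondegenerate ξ) {x : ℝ} (hx : x ≤ 1) :
    BddAbove (range fun n : ℕ => dyadicValue ξ n ⌊x * 2 ^ n⌋₊) :=
  ⟨1, forall_mem_range.2 fun n => (h.dyadicValue_mem (floor_mul_two_pow_le hx n)).2⟩

theorem IsNondegenerate.dyadicLimit_mem (h : IsNondegenerate ξ) {x : ℝ} (hx : x ≤ 1) :
    dyadicLimit ξ x ∈ I :=
  ⟨(h.dyadicValue_mem (floor_mul_two_pow_le hx 0)).1.trans (le_ciSup (h.bddAbove hx) 0),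
    ciSup_le fun n => (h.dyadicValue_mem (floor_mul_two_pow_le hx n)).2⟩

theorem IsNondegenerate.dyadicLimit_mono (h : IsNondegenerate ξ) {x y : ℝ} (hxy : x ≤ y)
    (hy : y ≤ 1) : dyadicLimit ξ x ≤ dyadicLimit ξ y :=
  ciSup_mono (h.bddAbove hy) fun n => h.monotoneOn n (by gcongr) (floor_mul_two_pow_le hy n)

theorem IsNondegenerate.dyadicLimit_eq (h : IsNondegenerate ξ) {n k : ℕ} (hk : k ≤ 2 ^ n) :
    dyadicLimit ξ ((k : ℝ) / 2 ^ n) = dyadicValue ξ n k := by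
  have h1 : (k : ℝ) / 2 ^ n ≤ 1 := by
    rw [div_le_one (by positivity)]
    exact_mod_cast hk
  refine le_antisymm (ciSup_le fun m => h.dyadicValue_mono hk ?_) ?_
  · exact floor_mul_two_pow_div_le (by positivity) m
  · have := le_ciSup (h.bddAbove h1) n
    rwa [div_mul_cancel₀ _ (by positivity), Nat.floor_natCast] at this

theorem exists_dyadic_between {x y : ℝ} (hx : 0 ≤ x) (hxy : x < y) (hy : y ≤ 1) :
    ∃ n k : ℕ, k + 1 ≤ 2 ^ n ∧ x < (k : ℝ) / 2 ^ n ∧ ((k + 1 : ℕ) : ℝ) / 2 ^ n < y := by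
  -- With more than three mesh widths in `(x, y)`, the two grid points following `x` both lie before
  -- `y`.
  obtain ⟨n, hn⟩ := pow_unbounded_of_one_lt (3 / (y - x)) one_lt_two
  have hyx : 0 < y - x := sub_pos.2 hxy
  have h2 : (0 : ℝ) < 2 ^ n := by positivity
  rw [div_lt_iff₀ hyx] at hn
  have f1 := Nat.floor_le (by positivity : 0 ≤ x * 2 ^ n)
  have f2 := Nat.lt_floor_add_one (x * 2 ^ n)
  have l2 : ((⌊x * 2 ^ n⌋₊ + 1 + 1 : ℕ) : ℝ) / 2 ^ n < y := by
    rw [div_lt_iff₀ h2]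
    push_cast
    nlinarith
  refine ⟨n, ⌊x * 2 ^ n⌋₊ + 1, ?_, ?_, l2⟩
  · have := l2.trans_le hy
    rw [div_lt_one h2] at this
    exact_mod_cast this.le
  · rw [lt_div_iff₀ h2]
    push_cast
    exact f2

theorem IsNondegenerate.dyadicLimit_strictMono (h : IsNondegenerate ξ) {x y : ℝ} (hx : 0 ≤ x)
    (hxy : x < y) (hy : y ≤ 1) : dyadicLimit ξ x < dyadicLimit ξ y := by
  obtain ⟨n, k, hk, h1, h2⟩ := exists_dyadic_between hx hxy hy
  have e1 : dyadicLimit ξ x ≤ dyadicValue ξ n k := by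
    rw [← h.dyadicLimit_eq (by omega : k ≤ 2 ^ n)]
    refine h.dyadicLimit_mono h1.le ?_
    rw [div_le_one (by positivity)]
    exact_mod_cast (by omega : k ≤ 2 ^ n)
  have e2 : dyadicValue ξ n (k + 1) ≤ dyadicLimit ξ y := by
    rw [← h.dyadicLimit_eq hk]
    exact h.dyadicLimit_mono h2.le hy
  exact (e1.trans_lt (h.lt_succ n k hk)).trans_le e2

/-- Each squared gap is at most `gapSum`, so all gaps of some generation are below `ε`. Values going
from `0` to `1` in such steps cannot cross `y` without coming within `ε` of it. -/
theorem exists_dyadicValue_near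
    (hS : Tendsto (gapSum ξ) atTop (𝓝 0)) (y : I) {ε : ℝ} (hε : 0 < ε) :
    ∃ n k : ℕ, k ≤ 2 ^ n ∧ |dyadicValue ξ n k - y| < ε := by
  obtain ⟨n, hn⟩ := (hS.eventually (gt_mem_nhds (by positivity : 0 < ε ^ 2))).exists
  have hgap : ∀ k < 2 ^ n, dyadicValue ξ n (k + 1) - dyadicValue ξ n k < ε := by
    intro k hk
    have h1 : (dyadicValue ξ n (k + 1) - dyadicValue ξ n k) ^ 2 ≤ gapSum ξ n :=
      Finset.single_le_sum
        (f := fun k => (dyadicValue ξ n (k + 1) - dyadicValue ξ n k) ^ 2)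
        (fun i _ => sq_nonneg _) (Finset.mem_range.2 hk)
    exact lt_of_pow_lt_pow_left₀ 2 hε.le (h1.trans_lt hn)
  by_contra! hcon
  have key : ∀ k ≤ 2 ^ n, dyadicValue ξ n k < y := by
    intro k
    induction k with
    | zero =>
      intro hk
      have h1 := hcon n 0 hk
      rw [dyadicValue_zero] at h1 ⊢
      rcases y.2.1.eq_or_lt with h0 | h0
      · rw [← h0] at h1
        simp at h1
        linarith
      · exact h0
    | succ k ih =>
      intro hk
      have h1 := ih (by omega)
      have h2 := hgap k (by omega)
      have h3 := hcon n (k + 1) hk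
      by_contra! h4
      rw [abs_of_nonneg (by linarith)] at h3
      linarith
  have := key (2 ^ n) le_rfl
  rw [dyadicValue_two_pow] at this
  linarith [y.2.2]

/-- Ratios inside `(0, 1)` make the limit function strictly increasing. Vanishing gaps make its
range dense, and a monotone map with dense range is continuous. -/
theorem IsNondegenerate.exists_extends (h : IsNondegenerate ξ)
    (hS : Tendsto (gapSum ξ) atTop (𝓝 0)) : ∃ φ : I ≃o I, Extends ξ φ := by
  set F : I → I := fun x => ⟨dyadicLimit ξ x, h.dyadicLimit_mem x.2.2⟩ with hF
  have hmono : StrictMono F := fun x y hxy => h.dyadicLimit_strictMono x.2.1 hxy y.2.2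
  have hdy : ∀ n k : ℕ, k ≤ 2 ^ n → ∃ x : I, ((F x : I) : ℝ) = dyadicValue ξ n k := by
    intro n k hk
    refine ⟨⟨(k : ℝ) / 2 ^ n, by positivity, ?_⟩, h.dyadicLimit_eq hk⟩
    rw [div_le_one (by positivity)]
    exact_mod_cast hk
  have hdense : DenseRange F := by
    intro y
    rw [Metric.mem_closure_iff]
    intro ε hε
    obtain ⟨n, k, hk, hd⟩ := exists_dyadicValue_near hS y hε
    obtain ⟨x, hx⟩ := hdy n k hk
    refine ⟨F x, mem_range_self x, ?_⟩
    rw [dist_comm, Subtype.dist_eq, Real.dist_eq, hx]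
    exact hd
  have hcont : Continuous F := hmono.monotone.continuous_of_denseRange hdense
  have hsurj : Function.Surjective F := by
    intro y
    refine mem_range_of_exists_le_of_exists_ge hcont ?_ ?_
    · obtain ⟨x, hx⟩ := hdy 0 0 (by simp)
      refine ⟨x, ?_⟩
      rw [← Subtype.coe_le_coe, hx, dyadicValue_zero]
      exact y.2.1
    · obtain ⟨x, hx⟩ := hdy 0 1 (by simp)
      refine ⟨x, ?_⟩
      rw [← Subtype.coe_le_coe, hx]
      exact y.2.2.trans_eq (dyadicValue_two_pow ξ 0).symm
  refine ⟨StrictMono.orderIsoOfSurjective F hmono hsurj, fun x n k hx => ?_⟩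
  have hk : k ≤ 2 ^ n := by
    have h1 : (k : ℝ) / 2 ^ n ≤ 1 := hx ▸ x.2.2
    rw [div_le_one (by positivity)] at h1
    exact_mod_cast h1
  change dyadicLimit ξ x = _
  rw [hx, h.dyadicLimit_eq hk]

theorem gapSum_succ (ξ : ℕ → ℕ → ℝ) (n : ℕ) :
    gapSum ξ (n + 1) = ξ 1 1 ^ 2 * gapSum (fun n k => ξ (n + 1) k) n +
      (1 - ξ 1 1) ^ 2 * gapSum (fun n k => ξ (n + 1) (2 ^ n + k)) n := by
  rw [gapSum, pow_succ, mul_two, Finset.sum_range_add, gapSum, gapSum, Finset.mul_sum,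
    Finset.mul_sum]
  congr 1
  · refine Finset.sum_congr rfl fun k hk => ?_
    rw [Finset.mem_range] at hk
    rw [dyadicValue_left ξ n _ hk, dyadicValue_left ξ n _ hk.le]
    ring
  · refine Finset.sum_congr rfl fun k hk => ?_
    rw [Finset.mem_range] at hk
    rw [add_assoc, dyadicValue_right ξ n _ hk, dyadicValue_right ξ n _ hk.le]
    ring

theorem gapSum_congr {ξ' : ℕ → ℕ → ℝ} (h : ∀ n k, Odd k → k < 2 ^ n → ξ n k = ξ' n k) (n : ℕ) :
    gapSum ξ n = gapSum ξ' n := by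
  refine Finset.sum_congr rfl fun k hk => ?_
  rw [Finset.mem_range] at hk
  rw [dyadicValue_congr h n _ hk, dyadicValue_congr h n _ hk.le]

end Homeomorphism

/-! ### Almost sure existence -/

section AlmostSure

/-- The ratios `w`, extended by zero to the unused indices. -/
def nodeFun (w : Node → ℝ) (n k : ℕ) : ℝ :=
  if h : Odd k ∧ k < 2 ^ n then w ⟨(n, k), h⟩ else 0

theorem nodeFun_of_mem (w : Node → ℝ) {n k : ℕ} (h : Odd k) (h' : k < 2 ^ n) :
    nodeFun w n k = w ⟨(n, k), h, h'⟩ := dif_pos ⟨h, h'⟩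

theorem nodeFun_root (w : Node → ℝ) : nodeFun w 1 1 = (split w).1 :=
  nodeFun_of_mem w odd_one (by norm_num)

theorem nodeFun_left (w : Node → ℝ) {n k : ℕ} (h : Odd k) (h' : k < 2 ^ n) :
    nodeFun w (n + 1) k = nodeFun (split w).2.1 n k := by
  rw [nodeFun_of_mem w h (h'.trans (Nat.pow_lt_pow_succ one_lt_two)), nodeFun_of_mem _ h h']
  rfl

theorem nodeFun_right (w : Node → ℝ) {n k : ℕ} (h : Odd k) (h' : k < 2 ^ n) :
    nodeFun w (n + 1) (2 ^ n + k) = nodeFun (split w).2.2 n k := by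
  rw [nodeFun_of_mem (split w).2.2 h h']
  exact nodeFun_of_mem w (Node.right ⟨(n, k), h, h'⟩).2.1 (Node.right ⟨(n, k), h, h'⟩).2.2

theorem measurable_nodeFun (n k : ℕ) : Measurable fun w => nodeFun w n k := by
  unfold nodeFun
  split_ifs with h
  · exact measurable_pi_apply _
  · exact measurable_const

theorem measurable_dyadicValue (n k : ℕ) : Measurable fun w => dyadicValue (nodeFun w) n k := by
  induction n generalizing k with
  | zero => exact measurable_const
  | succ n ih =>
    rcases Nat.even_or_odd' k with ⟨m, rfl | rfl⟩
    · simp_rw [dyadicValue_even]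
      exact ih m
    · simp_rw [dyadicValue_odd]
      exact (ih m).add ((measurable_nodeFun _ _).mul ((ih _).sub (ih _)))

theorem measurable_dyadicLimit :
    Measurable fun q : (Node → ℝ) × ℝ => dyadicLimit (nodeFun q.1) q.2 := by
  refine Measurable.iSup fun n => ?_
  have h1 : Measurable fun q : (Node → ℝ) × ℕ => dyadicValue (nodeFun q.1) n q.2 :=
    measurable_from_prod_countable_left fun k => measurable_dyadicValue n k
  exact h1.comp (measurable_fst.prodMk (Nat.measurable_floor.comp (measurable_snd.mul_const _)))

theorem measurable_gapSum (n : ℕ) : Measurable fun w => gapSum (nodeFun w) n :=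
  Finset.measurable_sum _ fun k _ =>
    ((measurable_dyadicValue n (k + 1)).sub (measurable_dyadicValue n k)).pow_const 2

/-- The ratios from which a homeomorphism is constructed. -/
def goodRatios : Set (Node → ℝ) :=
  {w | (∀ j, w j ∈ Ioo (0 : ℝ) 1) ∧ Tendsto (gapSum (nodeFun w)) atTop (𝓝 0)}

theorem measurableSet_goodRatios : MeasurableSet goodRatios := by
  have h : goodRatios = (⋂ j, (fun w : Node → ℝ => w j) ⁻¹' Ioo (0 : ℝ) 1) ∩
      {w | Tendsto (fun n => gapSum (nodeFun w) n) atTop (𝓝 0)} := by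
    ext w
    simp only [goodRatios, mem_inter_iff, mem_iInter, mem_preimage, mem_ofPred_eq]
  rw [h]
  exact (MeasurableSet.iInter fun j => measurable_pi_apply j measurableSet_Ioo).inter
    (measurableSet_tendsto _ measurable_gapSum)

theorem gapSum_nonneg (ξ : ℕ → ℕ → ℝ) (n : ℕ) : 0 ≤ gapSum ξ n :=
  Finset.sum_nonneg fun _ _ => sq_nonneg _

theorem gapSum_nodeFun_succ (w : Node → ℝ) (n : ℕ) :
    gapSum (nodeFun w) (n + 1) = (split w).1 ^ 2 * gapSum (nodeFun (split w).2.1) n +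
      (1 - (split w).1) ^ 2 * gapSum (nodeFun (split w).2.2) n := by
  rw [gapSum_succ, gapSum_congr fun n k h h' => nodeFun_left w h h',
    gapSum_congr fun n k h h' => nodeFun_right w h h', nodeFun_root]

theorem lintegral_sq_unif : ∫⁻ u, ENNReal.ofReal (u ^ 2) ∂unif = ENNReal.ofReal (1 / 3) := by
  rw [← ofReal_integral_eq_lintegral_ofReal]
  · rw [unif, integral_Icc_eq_integral_Ioc, ← intervalIntegral.integral_of_le zero_le_one,
      integral_pow]
    norm_num
  · exact (continuous_pow 2).continuousOn.integrableOn_compact isCompact_Icc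
  · exact Eventually.of_forall fun u => sq_nonneg u

theorem lintegral_one_sub_sq_unif :
    ∫⁻ u, ENNReal.ofReal ((1 - u) ^ 2) ∂unif = ENNReal.ofReal (1 / 3) := by
  rw [← ofReal_integral_eq_lintegral_ofReal]
  · rw [unif, integral_Icc_eq_integral_Ioc, ← intervalIntegral.integral_of_le zero_le_one,
      intervalIntegral.integral_comp_sub_left (fun u => u ^ 2), integral_pow]
    norm_num
  · exact ((continuous_const.sub continuous_id).pow 2).continuousOn.integrableOn_compact
      isCompact_Icc
  · exact Eventually.of_forall fun u => sq_nonneg _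

/-- The squared gaps in the two halves are scaled by `u ^ 2` and `(1 - u) ^ 2`, independently of the
halves, and each factor has mean `1 / 3`. -/
theorem lintegral_gapSum (n : ℕ) :
    ∫⁻ w, ENNReal.ofReal (gapSum (nodeFun w) n) ∂nodeLaw = ENNReal.ofReal (2 / 3) ^ n := by
  induction n with
  | zero => simp [gapSum, dyadicValue]
  | succ n ih =>
    have hg : Measurable fun w => ENNReal.ofReal (gapSum (nodeFun w) n) :=
      (measurable_gapSum n).ennreal_ofReal
    have hsq : Measurable fun u : ℝ => ENNReal.ofReal (u ^ 2) := by fun_prop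
    have hsq' : Measurable fun u : ℝ => ENNReal.ofReal ((1 - u) ^ 2) := by fun_prop
    set F : ℝ × (Node → ℝ) × (Node → ℝ) → ENNReal := fun q =>
      ENNReal.ofReal (q.1 ^ 2) * ENNReal.ofReal (gapSum (nodeFun q.2.1) n) +
        ENNReal.ofReal ((1 - q.1) ^ 2) * ENNReal.ofReal (gapSum (nodeFun q.2.2) n) with hF
    have hFm : Measurable F :=
      ((hsq.comp measurable_fst).mul (hg.comp (measurable_fst.comp measurable_snd))).add
        ((hsq'.comp measurable_fst).mul (hg.comp (measurable_snd.comp measurable_snd)))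
    have h1 : ∀ w, ENNReal.ofReal (gapSum (nodeFun w) (n + 1)) = F (split w) := by
      intro w
      rw [gapSum_nodeFun_succ, ENNReal.ofReal_add (mul_nonneg (sq_nonneg _) (gapSum_nonneg _ _))
        (mul_nonneg (sq_nonneg _) (gapSum_nonneg _ _)), ENNReal.ofReal_mul (sq_nonneg _),
        ENNReal.ofReal_mul (sq_nonneg _)]
    simp_rw [h1]
    rw [measurePreserving_split.lintegral_comp hFm, lintegral_prod _ hFm.aemeasurable]
    have h2 : ∀ u : ℝ, ∫⁻ q, F (u, q) ∂(nodeLaw.prod nodeLaw) =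
        ENNReal.ofReal (u ^ 2) * ENNReal.ofReal (2 / 3) ^ n +
          ENNReal.ofReal ((1 - u) ^ 2) * ENNReal.ofReal (2 / 3) ^ n := by
      intro u
      have m1 : Measurable fun q : (Node → ℝ) × (Node → ℝ) =>
        ENNReal.ofReal (gapSum (nodeFun q.1) n) := hg.comp measurable_fst
      have m2 : Measurable fun q : (Node → ℝ) × (Node → ℝ) =>
        ENNReal.ofReal (gapSum (nodeFun q.2) n) := hg.comp measurable_snd
      simp only [hF]
      rw [lintegral_add_left (m1.const_mul _), lintegral_const_mul _ m1, lintegral_const_mul _ m2,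
        measurePreserving_fst.lintegral_comp hg, measurePreserving_snd.lintegral_comp hg, ih]
    simp_rw [h2]
    rw [lintegral_add_left (hsq.mul_const _), lintegral_mul_const _ hsq,
      lintegral_mul_const _ hsq', lintegral_sq_unif, lintegral_one_sub_sq_unif, ← add_mul,
      ← ENNReal.ofReal_add (by norm_num) (by norm_num), pow_succ', ← ENNReal.ofReal_pow (by norm_num)]
    norm_num

theorem ae_unif_mem_Ioo : ∀ᵐ u ∂unif, u ∈ Ioo (0 : ℝ) 1 := by
  rw [unif, ← restrict_Ioo_eq_restrict_Icc]
  exact ae_restrict_mem measurableSet_Ioo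

theorem ae_mem_Ioo : ∀ᵐ w ∂nodeLaw, ∀ j, w j ∈ Ioo (0 : ℝ) 1 := by
  refine ae_all_iff.2 fun j => ?_
  exact (measurePreserving_eval_infinitePi (fun _ : Node => unif) j).quasiMeasurePreserving.ae
    ae_unif_mem_Ioo

/-- The expectations form a convergent geometric series, so `gapSum` is almost surely summable and
tends to `0`. -/
theorem ae_mem_goodRatios : ∀ᵐ w ∂nodeLaw, w ∈ goodRatios := by
  have h1 : ∫⁻ w, ∑' n, ENNReal.ofReal (gapSum (nodeFun w) n) ∂nodeLaw ≠ ⊤ := by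
    rw [lintegral_tsum fun n => ((measurable_gapSum n).ennreal_ofReal).aemeasurable]
    simp_rw [lintegral_gapSum]
    rw [ENNReal.tsum_geometric]
    simp only [ne_eq, ENNReal.inv_eq_top, tsub_eq_zero_iff_le, not_le]
    rw [← ENNReal.ofReal_one]
    exact (ENNReal.ofReal_lt_ofReal_iff one_pos).2 (by norm_num)
  have h2 := ae_lt_top
    (Measurable.tsum fun n => (measurable_gapSum n).ennreal_ofReal) h1
  filter_upwards [ae_mem_Ioo, h2] with w hw hw'
  refine ⟨hw, ?_⟩
  have h3 := ENNReal.tendsto_atTop_zero_of_tsum_ne_top hw'.ne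
  have h4 := (ENNReal.tendsto_toReal ENNReal.zero_ne_top).comp h3
  simpa [Function.comp_def, gapSum_nonneg] using h4

theorem exists_extends_of_mem {w : Node → ℝ} (hw : w ∈ goodRatios) :
    ∃ φ : I ≃o I, Extends (nodeFun w) φ := by
  refine IsNondegenerate.exists_extends (fun n k h h' => ?_) hw.2
  rw [nodeFun_of_mem w h h']
  exact hw.1 _

theorem ae_exists_extends {Ω : Type*} [MeasurableSpace Ω] {P : Measure Ω} [IsProbabilityMeasure P]
    {X : ℕ → ℕ → Ω → ℝ} (hX : IsUniformFamily P X) :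
    ∀ᵐ ω ∂P, ∃ φ : I ≃o I, Extends (fun n k => X n k ω) φ := by
  filter_upwards [(map_eq_nodeLaw hX).quasiMeasurePreserving.ae ae_mem_goodRatios] with ω hω
  obtain ⟨φ, hφ⟩ := exists_extends_of_mem hω
  exact ⟨φ, hφ.congr fun n k h h' => nodeFun_of_mem _ h h'⟩

end AlmostSure

/-! ### The random homeomorphism and its transplants to subintervals -/

section RandomHomeomorphism

open Classical in
/-- The homeomorphism with the division ratios `w`. -/
noncomputable def homeo (w : Node → ℝ) : I ≃o I :=
  if h : w ∈ goodRatios then (exists_extends_of_mem h).choose else OrderIso.refl I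

theorem extends_homeo {w : Node → ℝ} (h : w ∈ goodRatios) : Extends (nodeFun w) (homeo w) := by
  rw [homeo, dif_pos h]
  exact (exists_extends_of_mem h).choose_spec

theorem measurable_homeo : Measurable fun q : (Node → ℝ) × I => ((homeo q.1 q.2 : I) : ℝ) := by
  classical
  -- The choice in `homeo` does no harm: on good ratios it is given by the supremum formula,
  -- elsewhere it is the identity.
  have h : (fun q : (Node → ℝ) × I => ((homeo q.1 q.2 : I) : ℝ)) = fun q =>
      if q.1 ∈ goodRatios then dyadicLimit (nodeFun q.1) q.2 else (q.2 : ℝ) := by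
    funext q
    split_ifs with hq
    · exact (extends_homeo hq).eq_dyadicLimit _
    · rw [homeo, dif_neg hq]
      rfl
  rw [h]
  refine Measurable.ite (measurable_fst measurableSet_goodRatios) ?_
    (measurable_subtype_coe.comp measurable_snd)
  exact measurable_dyadicLimit.comp
    (measurable_fst.prodMk (measurable_subtype_coe.comp measurable_snd))

/-- Self-similarity of `φ`: `dyadicValue_left` holds along the dyadic approximations of `s / 2` and
`s`, and passes to the limit. -/
theorem homeo_left {w : Node → ℝ} (hw : w ∈ goodRatios) (hl : (split w).2.1 ∈ goodRatios) {s v : I}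
    (hv : (v : ℝ) = s / 2) :
    ((homeo w v : I) : ℝ) = (split w).1 * (homeo (split w).2.1 s : I) := by
  have h1 := ((extends_homeo hw).tendsto v).comp (tendsto_add_atTop_nat 1)
  have h2 := ((extends_homeo hl).tendsto s).const_mul (split w).1
  refine tendsto_nhds_unique h1 (h2.congr fun n => ?_)
  have e : (v : ℝ) * 2 ^ (n + 1) = s * 2 ^ n := by rw [hv]; ring
  have hk := floor_mul_two_pow_le s.2.2 n
  rw [Function.comp_apply, e, dyadicValue_left _ n _ hk, nodeFun_root,
    dyadicValue_congr (fun n k h h' => nodeFun_left w h h') n _ hk]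

theorem homeo_right {w : Node → ℝ} (hw : w ∈ goodRatios) (hr : (split w).2.2 ∈ goodRatios) {s v : I}
    (hv : (v : ℝ) = (1 + s) / 2) :
    ((homeo w v : I) : ℝ) =
      (split w).1 + (1 - (split w).1) * (homeo (split w).2.2 s : I) := by
  have h1 := ((extends_homeo hw).tendsto v).comp (tendsto_add_atTop_nat 1)
  have h2 := (((extends_homeo hr).tendsto s).const_mul (1 - (split w).1)).const_add (split w).1
  refine tendsto_nhds_unique h1 (h2.congr fun n => ?_)
  have e : (v : ℝ) * 2 ^ (n + 1) = s * 2 ^ n + ((2 ^ n : ℕ) : ℝ) := by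
    rw [hv]
    push_cast
    ring
  have hk := floor_mul_two_pow_le s.2.2 n
  have hs : (0 : ℝ) ≤ s * 2 ^ n := mul_nonneg s.2.1 (by positivity)
  rw [Function.comp_apply, e, Nat.floor_add_natCast hs, add_comm ⌊(s : ℝ) * 2 ^ n⌋₊,
    dyadicValue_right _ n _ hk, nodeFun_root,
    dyadicValue_congr (fun n k h h' => nodeFun_right w h h') n _ hk]

/-- The homeomorphism `φ`, transplanted to the interval `[x, y]` and extended by the identity. -/
noncomputable def localMap (φ : I ≃o I) (x y : I) (s : ℝ) : ℝ :=
  s + ((y : ℝ) - x) * (((φ (projIcc 0 1 zero_le_one ((s - x) / (y - x))) : I) : ℝ) -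
    (projIcc (0 : ℝ) 1 zero_le_one ((s - x) / (y - x)) : I))

theorem continuous_localMap (φ : I ≃o I) (x y : I) : Continuous (localMap φ x y) := by
  unfold localMap
  have h1 : Continuous fun s : ℝ => (s - x) / ((y : ℝ) - x) := by fun_prop
  have h2 := continuous_projIcc (h := zero_le_one' ℝ) |>.comp h1
  exact continuous_id.add (continuous_const.mul
    ((continuous_subtype_val.comp (φ.continuous.comp h2)).sub (continuous_subtype_val.comp h2)))

theorem localMap_of_le (φ : I ≃o I) {x y : I} {s : ℝ} (h : (s - x) / ((y : ℝ) - x) ≤ 0) :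
    localMap φ x y s = s := by
  rw [localMap, projIcc_of_le_left zero_le_one h]
  have : (⟨0, left_mem_Icc.2 zero_le_one⟩ : I) = ⊥ := rfl
  rw [this, φ.map_bot]
  simp

theorem localMap_of_ge (φ : I ≃o I) {x y : I} {s : ℝ} (h : 1 ≤ (s - x) / ((y : ℝ) - x)) :
    localMap φ x y s = s := by
  rw [localMap, projIcc_of_right_le zero_le_one h]
  have : (⟨1, right_mem_Icc.2 zero_le_one⟩ : I) = ⊤ := rfl
  rw [this, φ.map_top]
  simp

/-- No order between `x` and `y` is assumed, because `localComp` has to be well defined on the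
circle for every pair. For `x = y` the prefactor vanishes; for `x > y` the quotient changes sign. -/
theorem localMap_zero (φ : I ≃o I) (x y : I) : localMap φ x y 0 = 0 := by
  rcases lt_trichotomy (x : ℝ) y with h | h | h
  · exact localMap_of_le φ (div_nonpos_of_nonpos_of_nonneg (by linarith [x.2.1]) (by linarith))
  · simp [localMap, h]
  · refine localMap_of_ge φ ?_
    rw [le_div_iff_of_neg (by linarith)]
    linarith [y.2.1]

theorem localMap_one (φ : I ≃o I) (x y : I) : localMap φ x y 1 = 1 := by
  rcases lt_trichotomy (x : ℝ) y with h | h | h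
  · refine localMap_of_ge φ ?_
    rw [le_div_iff₀ (by linarith)]
    linarith [y.2.2]
  · simp [localMap, h]
  · exact localMap_of_le φ (div_nonpos_of_nonneg_of_nonpos (by linarith [x.2.2]) (by linarith))

theorem localMap_eq (φ : I ≃o I) {x y : I} (hxy : x < y) {s : ℝ} {v : I}
    (hv : s = x + ((y : ℝ) - x) * v) :
    localMap φ x y s = x + ((y : ℝ) - x) * (φ v : I) := by
  have h : (y : ℝ) - x ≠ 0 := (sub_pos.2 (Subtype.coe_lt_coe.2 hxy)).ne'
  have e : (s - x) / ((y : ℝ) - x) = v := by rw [hv]; field_simp; ring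
  rw [localMap, e, projIcc_val, hv]
  ring

variable {𝕜 : Type*} [RCLike 𝕜]

/-- The function `f ∘ localMap φ x y` on the circle. -/
noncomputable def localComp (f : C(UnitAddCircle, 𝕜)) (φ : I ≃o I) (x y : I) :
    C(UnitAddCircle, 𝕜) where
  toFun := AddCircle.liftIco 1 0 (fun t : ℝ => f (localMap φ x y t : UnitAddCircle))
  continuous_toFun := by
    apply AddCircle.liftIco_continuous
    · rw [zero_add, localMap_zero, localMap_one]
      congr 1
      simpa using (AddCircle.coe_period (1 : ℝ)).symm
    · exact (f.continuous.comp ((AddCircle.continuous_mk' 1).comp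
        (continuous_localMap φ x y))).continuousOn

theorem localComp_apply (f : C(UnitAddCircle, 𝕜)) (φ : I ≃o I) (x y : I) {s : ℝ} (hs : s ∈ I) :
    localComp f φ x y (s : UnitAddCircle) = f (localMap φ x y s : UnitAddCircle) := by
  have key : ∀ s : ℝ, 0 ≤ s → s < 1 →
      localComp f φ x y (s : UnitAddCircle) = f (localMap φ x y s : UnitAddCircle) := by
    intro s h0 h1
    exact AddCircle.liftIco_coe_apply (p := (1 : ℝ)) (a := 0)
      (f := fun t : ℝ => f (localMap φ x y t : UnitAddCircle)) ⟨h0, by simpa using h1⟩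
  rcases lt_or_eq_of_le hs.2 with h | h
  · exact key s hs.1 h
  · have c : ((1 : ℝ) : UnitAddCircle) = ((0 : ℝ) : UnitAddCircle) := by simp
    rw [h, localMap_one, c, key 0 le_rfl one_pos, localMap_zero]

theorem exists_coe_eq (c : UnitAddCircle) : ∃ s : I, ((s : ℝ) : UnitAddCircle) = c := by
  have h := AddCircle.coe_image_Ico_eq (1 : ℝ) 0
  obtain ⟨s, hs, rfl⟩ := h.symm ▸ mem_univ c
  rw [zero_add] at hs
  exact ⟨⟨s, hs.1, hs.2.le⟩, rfl⟩

theorem localComp_zero_one (f : C(UnitAddCircle, 𝕜)) (φ : I ≃o I) :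
    localComp f φ 0 1 = circleComp f φ := by
  ext c
  obtain ⟨s, rfl⟩ := exists_coe_eq c
  rw [localComp_apply f φ 0 1 s.2, circleComp_apply,
    localMap_eq φ (x := 0) (y := 1) zero_lt_one (v := s) (by simp)]
  simp

end RandomHomeomorphism

/-! ### Borel measurability of the composed function -/

section Measurability

/-- A map into the continuous functions on a compact space is Borel measurable as soon as the
distances of its values at points to constants are measurable. -/
theorem measurable_borel_of_eval {α K E : Type*} [MeasurableSpace α] [TopologicalSpace K]
    [CompactSpace K] [TopologicalSpace.SeparableSpace K] [Nonempty K] [PseudoMetricSpace E]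
    [SecondCountableTopology C(K, E)] {g : α → C(K, E)}
    (hg : ∀ t c, Measurable fun a => dist (g a t) c) :
    Measurable[_, borel C(K, E)] g := by
  have hdist : ∀ f : C(K, E), Measurable fun a => dist (g a) f := by
    intro f
    refine measurable_of_Iic fun r => ?_
    rcases lt_or_ge r 0 with hr | hr
    · convert MeasurableSet.empty
      ext a
      simp only [mem_preimage, mem_Iic, mem_empty_iff_false, iff_false, not_le]
      exact hr.trans_le dist_nonneg
    · have : (fun a => dist (g a) f) ⁻¹' Iic r = ⋂ n : ℕ,
          (fun a => dist (g a (TopologicalSpace.denseSeq K n)) (f (TopologicalSpace.denseSeq K n)))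
            ⁻¹' Iic r := by
        ext a
        simp only [mem_preimage, mem_Iic, mem_iInter]
        rw [ContinuousMap.dist_le hr]
        refine ⟨fun h n => h _, fun h => ?_⟩
        exact isClosed_property (TopologicalSpace.denseRange_denseSeq K)
          (isClosed_le ((g a).continuous.dist f.continuous) continuous_const) h
      rw [this]
      exact MeasurableSet.iInter fun n => hg _ _ measurableSet_Iic
  have hbasis : TopologicalSpace.IsTopologicalBasis
      {s : Set C(K, E) | ∃ f r, s = Metric.ball f r} := by
    refine TopologicalSpace.isTopologicalBasis_of_isOpen_of_nhds ?_ ?_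
    · rintro _ ⟨f, r, rfl⟩
      exact Metric.isOpen_ball
    · intro f U hf hU
      obtain ⟨r, hr, hsub⟩ := Metric.isOpen_iff.1 hU f hf
      exact ⟨_, ⟨f, r, rfl⟩, Metric.mem_ball_self hr, hsub⟩
  rw [borel_eq_generateFrom_of_subbasis hbasis.eq_generateFrom]
  refine measurable_generateFrom ?_
  rintro _ ⟨f, r, rfl⟩
  exact hdist f measurableSet_Iio

variable {𝕜 : Type*} [RCLike 𝕜]

theorem measurable_localMap (s : ℝ) :
    Measurable fun q : (Node → ℝ) × I × I => localMap (homeo q.1) q.2.1 q.2.2 s := by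
  have hx : Measurable fun q : (Node → ℝ) × I × I => ((q.2.1 : I) : ℝ) :=
    measurable_subtype_coe.comp (measurable_fst.comp measurable_snd)
  have hy : Measurable fun q : (Node → ℝ) × I × I => ((q.2.2 : I) : ℝ) :=
    measurable_subtype_coe.comp (measurable_snd.comp measurable_snd)
  have hv : Measurable fun q : (Node → ℝ) × I × I =>
      projIcc (0 : ℝ) 1 zero_le_one ((s - q.2.1) / ((q.2.2 : ℝ) - q.2.1)) :=
    continuous_projIcc.measurable.comp ((measurable_const.sub hx).div (hy.sub hx))
  exact measurable_const.add ((hy.sub hx).mul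
    ((measurable_homeo.comp (measurable_fst.prodMk hv)).sub (measurable_subtype_coe.comp hv)))

/-- The triples `(w, x, y)` for which `T` holds on `[x, y]` for the composition of `f` with the
transplanted homeomorphism. -/
def localEvent (T : C(UnitAddCircle, 𝕜) → I → I → Fin 2) (f : C(UnitAddCircle, 𝕜)) :
    Set ((Node → ℝ) × I × I) :=
  {q | q.2.1 ≤ q.2.2 ∧ T (localComp f (homeo q.1) q.2.1 q.2.2) q.2.1 q.2.2 = 1}

theorem measurableSet_localEvent {T : C(UnitAddCircle, 𝕜) → I → I → Fin 2}
    (hT : IsIntervalProperty T) (f : C(UnitAddCircle, 𝕜)) : MeasurableSet (localEvent T f) := by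
  let _ : MeasurableSpace C(UnitAddCircle, 𝕜) := borel _
  have : BorelSpace C(UnitAddCircle, 𝕜) := ⟨rfl⟩
  have hm : Measurable fun q : (Node → ℝ) × I × I => localComp f (homeo q.1) q.2.1 q.2.2 := by
    refine measurable_borel_of_eval fun t c => ?_
    obtain ⟨s, rfl⟩ := exists_coe_eq t
    simp_rw [localComp_apply f _ _ _ s.2]
    have hc : Continuous fun r : ℝ => dist (f (r : UnitAddCircle)) c :=
      (f.continuous.comp (AddCircle.continuous_mk' 1)).dist continuous_const
    exact hc.measurable.comp (measurable_localMap s)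
  have hb := hT.borel_measurable
  -- The Borel sets of the product form the product σ-algebra, so joint measurability can be checked
  -- by coordinates.
  rw [← BorelSpace.measurable_eq (α := C(UnitAddCircle, 𝕜) × I × I)] at hb
  exact (hm.prodMk measurable_snd) hb

end Measurability

/-! ### Splitting an interval property at the image of the midpoint -/

section Splitting

/-- The point dividing `[x, y]` in the ratio `u`. -/
noncomputable def divPoint (x y : I) (u : ℝ) : I :=
  projIcc 0 1 zero_le_one ((x : ℝ) + ((y : ℝ) - x) * u)

theorem measurable_divPoint (x y : I) : Measurable (divPoint x y) :=
  continuous_projIcc.measurable.comp (by fun_prop)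

theorem coe_divPoint {x y : I} (hxy : x ≤ y) {u : ℝ} (hu : u ∈ I) :
    (divPoint x y u : ℝ) = x + ((y : ℝ) - x) * u := by
  have h : (x : ℝ) ≤ y := hxy
  have hmem : (x : ℝ) + ((y : ℝ) - x) * u ∈ Icc (0 : ℝ) 1 :=
    ⟨add_nonneg x.2.1 (mul_nonneg (sub_nonneg.2 h) hu.1), by
      nlinarith [mul_le_of_le_one_right (sub_nonneg.2 h) hu.2, y.2.2]⟩
  rw [divPoint, projIcc_of_mem zero_le_one hmem]

theorem left_lt_divPoint {x y : I} (hxy : x < y) {u : ℝ} (hu : u ∈ Ioo (0 : ℝ) 1) :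
    x < divPoint x y u := by
  have h : (0 : ℝ) < y - x := sub_pos.2 hxy
  rw [← Subtype.coe_lt_coe, coe_divPoint hxy.le ⟨hu.1.le, hu.2.le⟩]
  linarith [mul_pos h hu.1]

theorem divPoint_lt_right {x y : I} (hxy : x < y) {u : ℝ} (hu : u ∈ Ioo (0 : ℝ) 1) :
    divPoint x y u < y := by
  have h : (0 : ℝ) < y - x := sub_pos.2 hxy
  rw [← Subtype.coe_lt_coe, coe_divPoint hxy.le ⟨hu.1.le, hu.2.le⟩]
  nlinarith [hu.2]

theorem preimage_affine_Icc {a b c d : ℝ} (hcd : c < d) (hab : a < b) :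
    (fun z : ℝ => (b - a) / (d - c) * z + (a - (b - a) / (d - c) * c)) ⁻¹' Icc a b = Icc c d := by
  have hr : 0 < (b - a) / (d - c) := div_pos (sub_pos.2 hab) (sub_pos.2 hcd)
  have hb : b - a = (b - a) / (d - c) * (d - c) := by
    rw [div_mul_cancel₀ _ (sub_pos.2 hcd).ne']
  set r := (b - a) / (d - c)
  ext z
  simp only [mem_preimage, mem_Icc]
  constructor
  · rintro ⟨h1, h2⟩
    constructor
    · by_contra! h
      nlinarith [mul_lt_mul_of_pos_left h hr]
    · by_contra! h
      nlinarith [mul_lt_mul_of_pos_left h hr]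
  · rintro ⟨h1, h2⟩
    constructor
    · nlinarith [mul_le_mul_of_nonneg_left h1 hr.le]
    · nlinarith [mul_le_mul_of_nonneg_left h2 hr.le]

variable {𝕜 : Type*} [RCLike 𝕜] {T : C(UnitAddCircle, 𝕜) → I → I → Fin 2}

/-- Affine invariance in the form used below: both intervals are parametrised by `[0, 1]`. -/
theorem IsIntervalProperty.eq_of_affine (hT : IsIntervalProperty T) {f g : C(UnitAddCircle, 𝕜)}
    {a b c d : I} (hab : a < b) (hcd : c < d)
    (h : ∀ v : I, g (((c : ℝ) + ((d : ℝ) - c) * v : ℝ) : UnitAddCircle) =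
      f (((a : ℝ) + ((b : ℝ) - a) * v : ℝ) : UnitAddCircle)) : T g c d = T f a b := by
  have hab' : (a : ℝ) < b := hab
  have hcd' : (c : ℝ) < d := hcd
  have hd : (d : ℝ) - c ≠ 0 := (sub_pos.2 hcd').ne'
  refine hT.affine f g (((b : ℝ) - a) / (d - c)) (a - ((b : ℝ) - a) / (d - c) * c) a b c d
    (div_pos (sub_pos.2 hab') (sub_pos.2 hcd')).ne' hab.le hcd.le
    (preimage_affine_Icc hcd' hab') fun z hz => ?_
  have hv : (z - c) / ((d : ℝ) - c) ∈ I :=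
    ⟨div_nonneg (sub_nonneg.2 hz.1) (sub_pos.2 hcd').le,
      (div_le_one (sub_pos.2 hcd')).2 (by linarith [hz.2])⟩
  have := h ⟨_, hv⟩
  have e1 : (c : ℝ) + ((d : ℝ) - c) * ((z - c) / ((d : ℝ) - c)) = z := by
    rw [mul_div_cancel₀ _ hd, add_sub_cancel]
  have e2 : (a : ℝ) + ((b : ℝ) - a) * ((z - c) / ((d : ℝ) - c)) =
      ((b : ℝ) - a) / (d - c) * z + (a - ((b : ℝ) - a) / (d - c) * c) := by ring
  simp only [e1, e2] at this
  exact this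

theorem localComp_line (f : C(UnitAddCircle, 𝕜)) (φ : I ≃o I) {x y : I} (hxy : x < y) (v : I) :
    localComp f φ x y (((x : ℝ) + ((y : ℝ) - x) * v : ℝ) : UnitAddCircle) =
      f (((x : ℝ) + ((y : ℝ) - x) * (φ v : I) : ℝ) : UnitAddCircle) := by
  rw [localComp_apply f φ x y (coe_divPoint hxy.le v.2 ▸ (divPoint x y v).2),
    localMap_eq φ hxy rfl]

/-- The value of an interval property splits at the image of the midpoint. -/
theorem IsIntervalProperty.split (hT : IsIntervalProperty T) (f : C(UnitAddCircle, 𝕜))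
    {w : Node → ℝ} (hw : w ∈ goodRatios) (hl : (split w).2.1 ∈ goodRatios)
    (hr : (split w).2.2 ∈ goodRatios) {x y t : I} (hxy : x < y)
    (ht : t = divPoint x y (RandomHomeo.split w).1) :
    T (localComp f (homeo w) x y) x y =
      T (localComp f (homeo (RandomHomeo.split w).2.1) x t) x t *
        T (localComp f (homeo (RandomHomeo.split w).2.2) t y) t y := by
  have hu : (RandomHomeo.split w).1 ∈ Ioo (0 : ℝ) 1 := hw.1 _
  set u := (RandomHomeo.split w).1 with hu_def
  have hxt : x < t := ht ▸ left_lt_divPoint hxy hu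
  have hty : t < y := ht ▸ divPoint_lt_right hxy hu
  have tval : (t : ℝ) = x + ((y : ℝ) - x) * u := ht ▸ coe_divPoint hxy.le ⟨hu.1.le, hu.2.le⟩
  have half : (1 / 2 : ℝ) ∈ Ioo (0 : ℝ) 1 := by norm_num
  -- Two division points occur: `m` halves the domain, while its image under the transplanted
  -- homeomorphism is `t`. The composite on `[x, m]` is the affine reparametrisation of the left
  -- subtree's composite on `[x, t]`.
  set m := divPoint x y (1 / 2) with hm
  have mval : (m : ℝ) = x + ((y : ℝ) - x) * (1 / 2) := coe_divPoint hxy.le ⟨half.1.le, half.2.le⟩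
  have hxm : x < m := left_lt_divPoint hxy half
  have hmy : m < y := divPoint_lt_right hxy half
  rw [hT.mul _ x m y hxm.le hmy.le]
  congr 1
  · refine hT.eq_of_affine hxt hxm fun s => ?_
    have hs : (s : ℝ) / 2 ∈ I := ⟨by linarith [s.2.1], by linarith [s.2.2]⟩
    have e : (x : ℝ) + ((m : ℝ) - x) * s = x + ((y : ℝ) - x) * (⟨(s : ℝ) / 2, hs⟩ : I) := by
      rw [mval]
      ring
    rw [e, localComp_line f _ hxy, localComp_line f _ hxt, homeo_left hw hl (s := s) rfl, tval]
    congr 2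
    ring
  · refine hT.eq_of_affine hty hmy fun s => ?_
    have hs : (1 + (s : ℝ)) / 2 ∈ I := ⟨by linarith [s.2.1], by linarith [s.2.2]⟩
    have e : (m : ℝ) + ((y : ℝ) - m) * s = x + ((y : ℝ) - x) * (⟨(1 + (s : ℝ)) / 2, hs⟩ : I) := by
      rw [mval]
      ring
    rw [e, localComp_line f _ hxy, localComp_line f _ hty, homeo_right hw hr (s := s) rfl, tval]
    congr 2
    ring

end Splitting

/-! ### Self-averaging of the probabilities and independence from the ratios -/

section SelfSimilarity

variable {𝕜 : Type*} [RCLike 𝕜] {T : C(UnitAddCircle, 𝕜) → I → I → Fin 2}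

theorem fin_two_mul_eq_one (a b : Fin 2) : a * b = 1 ↔ a = 1 ∧ b = 1 := by
  revert a b
  decide

/-- The section of `localEvent` over `(x, y)`. -/
def eventOn (T : C(UnitAddCircle, 𝕜) → I → I → Fin 2) (f : C(UnitAddCircle, 𝕜)) (x y : I) :
    Set (Node → ℝ) :=
  (fun w => (w, x, y)) ⁻¹' localEvent T f

theorem measurableSet_eventOn (hT : IsIntervalProperty T) (f : C(UnitAddCircle, 𝕜)) (x y : I) :
    MeasurableSet (eventOn T f x y) :=
  measurable_prodMk_right (measurableSet_localEvent hT f)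

theorem ae_mem_eventOn_iff (hT : IsIntervalProperty T) (f : C(UnitAddCircle, 𝕜)) {x y : I}
    (hxy : x < y) : ∀ᵐ w ∂nodeLaw, (w ∈ eventOn T f x y ↔
      (split w).2.1 ∈ eventOn T f x (divPoint x y (split w).1) ∧
        (split w).2.2 ∈ eventOn T f (divPoint x y (split w).1) y) := by
  have h1 := measurePreserving_split.quasiMeasurePreserving.ae
    ((Measure.quasiMeasurePreserving_snd (μ := unif) (ν := nodeLaw.prod nodeLaw)).ae
      ((Measure.quasiMeasurePreserving_fst (μ := nodeLaw) (ν := nodeLaw)).ae ae_mem_goodRatios))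
  have h2 := measurePreserving_split.quasiMeasurePreserving.ae
    ((Measure.quasiMeasurePreserving_snd (μ := unif) (ν := nodeLaw.prod nodeLaw)).ae
      ((Measure.quasiMeasurePreserving_snd (μ := nodeLaw) (ν := nodeLaw)).ae ae_mem_goodRatios))
  filter_upwards [ae_mem_goodRatios, h1, h2] with w hw hl hr
  have hu : (split w).1 ∈ Ioo (0 : ℝ) 1 := hw.1 _
  have hxt := left_lt_divPoint hxy hu
  have hty := divPoint_lt_right hxy hu
  have h := hT.split f hw hl hr hxy rfl
  simp only [eventOn, localEvent, mem_preimage, mem_ofPred_eq, hxy.le, hxt.le, hty.le, true_and, h,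
    fin_two_mul_eq_one]

/-- Given the root ratio `u`, the two subtrees are independent, so Fubini produces a product inside
the integral. Taking all sets `univ` gives the averaging equation; general sets serve the induction
over generations. -/
theorem measure_eventOn_inter (hT : IsIntervalProperty T) (f : C(UnitAddCircle, 𝕜)) {x y : I}
    (hxy : x < y) {B₀ : Set ℝ} {B₁ B₂ : Set (Node → ℝ)} (h₀ : MeasurableSet B₀)
    (h₁ : MeasurableSet B₁) (h₂ : MeasurableSet B₂) :
    nodeLaw (eventOn T f x y ∩ split ⁻¹' (B₀ ×ˢ (B₁ ×ˢ B₂))) =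
      ∫⁻ u in B₀, nodeLaw (eventOn T f x (divPoint x y u) ∩ B₁) *
        nodeLaw (eventOn T f (divPoint x y u) y ∩ B₂) ∂unif := by
  have hA := measurableSet_localEvent hT f
  have hD := measurable_divPoint x y
  set D : Set (ℝ × (Node → ℝ) × (Node → ℝ)) :=
    (fun q => (q.2.1, x, divPoint x y q.1)) ⁻¹' localEvent T f ∩
      (fun q => (q.2.2, divPoint x y q.1, y)) ⁻¹' localEvent T f with hDdef
  have hDm : MeasurableSet D := by
    refine MeasurableSet.inter ?_ ?_
    · exact ((measurable_fst.comp measurable_snd).prodMk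
        (measurable_const.prodMk (hD.comp measurable_fst))) hA
    · exact ((measurable_snd.comp measurable_snd).prodMk
        ((hD.comp measurable_fst).prodMk measurable_const)) hA
  have hB : MeasurableSet (B₀ ×ˢ (B₁ ×ˢ B₂)) := h₀.prod (h₁.prod h₂)
  have e1 : (eventOn T f x y ∩ split ⁻¹' (B₀ ×ˢ (B₁ ×ˢ B₂)) : Set (Node → ℝ)) =ᵐ[nodeLaw]
      split ⁻¹' (D ∩ B₀ ×ˢ (B₁ ×ˢ B₂)) := by
    rw [preimage_inter]
    refine Filter.EventuallyEq.inter ?_ Filter.EventuallyEq.rfl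
    filter_upwards [ae_mem_eventOn_iff hT f hxy] with w hw
    exact propext hw
  rw [measure_congr e1, measurePreserving_split.measure_preimage (hDm.inter hB).nullMeasurableSet,
    Measure.prod_apply (hDm.inter hB), ← lintegral_indicator h₀]
  refine lintegral_congr fun u => ?_
  by_cases hu : u ∈ B₀
  · rw [indicator_of_mem hu, ← Measure.prod_prod]
    congr 1
    ext q
    simp only [hDdef, mem_preimage, mem_inter_iff, mem_prod, eventOn]
    tauto
  · rw [indicator_of_notMem hu]
    have h : Prod.mk u ⁻¹' (D ∩ B₀ ×ˢ (B₁ ×ˢ B₂)) = ∅ := by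
      ext q
      simp [hu]
    rw [h, measure_empty]

/-- The probability of `T` on the transplanted homeomorphism. -/
noncomputable def prob (T : C(UnitAddCircle, 𝕜) → I → I → Fin 2) (f : C(UnitAddCircle, 𝕜))
    (x y : ℝ) : ℝ :=
  {q : ℝ × ℝ | 0 ≤ q.1 ∧ q.1 < q.2 ∧ q.2 ≤ 1}.indicator
    (fun q => nodeLaw.real (eventOn T f (projIcc 0 1 zero_le_one q.1)
      (projIcc 0 1 zero_le_one q.2))) (x, y)

theorem prob_of_lt (f : C(UnitAddCircle, 𝕜)) {x y : I} (hxy : x < y) :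
    prob T f x y = nodeLaw.real (eventOn T f x y) := by
  rw [prob, indicator_of_mem]
  · simp only [projIcc_val]
  · exact ⟨x.2.1, hxy, y.2.2⟩

/-- Transfers statements about almost every division point to almost every ratio. -/
theorem map_affine_unif_absolutelyContinuous {a b : ℝ} (hb : b ≠ 0) :
    (unif.map fun u => a + b * u) ≪ volume := by
  have h1 : (volume : Measure ℝ).map (fun u => b * u) ≪ volume := by
    rw [Real.map_volume_mul_left hb]
    exact Measure.smul_absolutelyContinuous
  have q1 : Measure.QuasiMeasurePreserving (fun u : ℝ => b * u) volume volume :=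
    ⟨measurable_const_mul b, h1⟩
  have q2 := (measurePreserving_add_left (volume : Measure ℝ) a).quasiMeasurePreserving.comp q1
  have h3 : unif ≪ (volume : Measure ℝ) := Measure.absolutelyContinuous_of_le Measure.restrict_le_self
  exact (h3.map q2.measurable).trans q2.absolutelyContinuous

theorem isSelfAveraging_prob (hT : IsIntervalProperty T) (f : C(UnitAddCircle, 𝕜)) :
    IsSelfAveraging (prob T f) where
  measurable := by
    have hS : MeasurableSet {q : ℝ × ℝ | 0 ≤ q.1 ∧ q.1 < q.2 ∧ q.2 ≤ 1} :=
      (measurableSet_le measurable_const measurable_fst).inter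
        ((measurableSet_lt measurable_fst measurable_snd).inter
          (measurableSet_le measurable_snd measurable_const))
    refine Measurable.indicator ?_ hS
    have h1 : Measurable fun r : I × I => nodeLaw.real (eventOn T f r.1 r.2) :=
      (measurable_measure_prodMk_right (measurableSet_localEvent hT f)).ennreal_toReal
    have h2 : Measurable (projIcc (0 : ℝ) 1 zero_le_one) := continuous_projIcc.measurable
    exact h1.comp ((h2.comp measurable_fst).prodMk (h2.comp measurable_snd))
  nonneg x y := indicator_nonneg (fun _ _ => measureReal_nonneg) _
  le_one x y := indicator_apply_le' (fun _ => measureReal_le_one) fun _ => zero_le_one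
  eq_integral x y hxy := by
    by_cases hx : 0 ≤ x
    · by_cases hy : y ≤ 1
      · lift x to I using ⟨hx, by linarith⟩
        lift y to I using ⟨by linarith, hy⟩
        have hxy' : x < y := hxy
        have hyx : (y : ℝ) - x ≠ 0 := (sub_pos.2 hxy).ne'
        have h1 := measure_eventOn_inter hT f hxy' MeasurableSet.univ MeasurableSet.univ
          MeasurableSet.univ
        simp only [univ_prod_univ, preimage_univ, inter_univ, Measure.restrict_univ] at h1
        have e := intervalIntegral.integral_comp_add_mul (a := 0) (b := 1)
          (fun t => prob T f x t * prob T f t y) hyx x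
        rw [mul_zero, add_zero, mul_one, add_sub_cancel, smul_eq_mul] at e
        have e2 : ((y : ℝ) - x) * ∫ u in 0..1,
            prob T f x (x + ((y : ℝ) - x) * u) * prob T f (x + ((y : ℝ) - x) * u) y =
            ∫ t in x..y, prob T f x t * prob T f t y := by
          rw [e, mul_inv_cancel_left₀ hyx]
        rw [← e2, prob_of_lt f hxy', measureReal_def, h1]
        congr 1
        have hm := measurable_measure_prodMk_right (μ := nodeLaw) (measurableSet_localEvent hT f)
        have hD := measurable_divPoint x y
        have m1 : Measurable fun u => nodeLaw (eventOn T f x (divPoint x y u)) :=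
          hm.comp (measurable_const.prodMk hD)
        have m2 : Measurable fun u => nodeLaw (eventOn T f (divPoint x y u) y) :=
          hm.comp (hD.prodMk measurable_const)
        have m3 : Measurable fun u => nodeLaw (eventOn T f x (divPoint x y u)) *
          nodeLaw (eventOn T f (divPoint x y u) y) := m1.mul m2
        rw [← integral_toReal m3.aemeasurable
          (Eventually.of_forall fun u => ENNReal.mul_lt_top (measure_lt_top _ _)
            (measure_lt_top _ _)),
          intervalIntegral.integral_of_le zero_le_one, ← integral_Icc_eq_integral_Ioc]
        refine integral_congr_ae ?_
        filter_upwards [ae_unif_mem_Ioo] with u hu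
        rw [ENNReal.toReal_mul, ← coe_divPoint hxy'.le ⟨hu.1.le, hu.2.le⟩,
          prob_of_lt f (left_lt_divPoint hxy' hu), prob_of_lt f (divPoint_lt_right hxy' hu)]
        rfl
      -- Outside the triangle the extension by zero makes one factor of the integrand vanish
      -- identically.
      · have h0 : ∀ t, prob T f t y = 0 := fun t =>
          indicator_of_notMem (fun h => hy h.2.2) _
        simp [h0]
    · have h0 : ∀ t, prob T f x t = 0 := fun t => indicator_of_notMem (fun h => hx h.1) _
      simp [h0]

/-- The conditional probability of the event, given the image of the midpoint, is constant. -/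
theorem ae_measure_eventOn_mul (hT : IsIntervalProperty T) (f : C(UnitAddCircle, 𝕜)) {x y : I}
    (hxy : x < y) : ∀ᵐ u ∂unif, nodeLaw (eventOn T f x (divPoint x y u)) *
      nodeLaw (eventOn T f (divPoint x y u) y) = nodeLaw (eventOn T f x y) := by
  have hyx : (y : ℝ) - x ≠ 0 := (sub_pos.2 (Subtype.coe_lt_coe.2 hxy)).ne'
  have h := ae_of_ae_map (by fun_prop) ((map_affine_unif_absolutelyContinuous (a := x)
    hyx).ae_le (isSelfAveraging_prob hT f).ae_eq_mul)
  filter_upwards [h, ae_unif_mem_Ioo] with u hu hu'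
  have hxt := left_lt_divPoint hxy hu'
  have hty := divPoint_lt_right hxy hu'
  have := hu x y
  rw [← coe_divPoint hxy.le ⟨hu'.1.le, hu'.2.le⟩] at this
  have := this hxt hty
  rw [prob_of_lt f hxt, prob_of_lt f hty, prob_of_lt f hxy] at this
  simp only [measureReal_def] at this
  rw [← ENNReal.toReal_mul, ENNReal.toReal_eq_toReal_iff' (measure_ne_top _ _)
    (ENNReal.mul_ne_top (measure_ne_top _ _) (measure_ne_top _ _))] at this
  exact this.symm

theorem nodeLaw_split_preimage {B₀ : Set ℝ} {B₁ B₂ : Set (Node → ℝ)} (h₀ : MeasurableSet B₀)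
    (h₁ : MeasurableSet B₁) (h₂ : MeasurableSet B₂) :
    nodeLaw (split ⁻¹' (B₀ ×ˢ (B₁ ×ˢ B₂))) = unif B₀ * (nodeLaw B₁ * nodeLaw B₂) := by
  rw [measurePreserving_split.measure_preimage (h₀.prod (h₁.prod h₂)).nullMeasurableSet,
    Measure.prod_prod, Measure.prod_prod]

theorem univ_pi_eq_split_preimage (t : Node → Set ℝ) :
    univ.pi t = split ⁻¹' (t Node.root ×ˢ
      (univ.pi (fun j => t j.left) ×ˢ univ.pi fun j => t j.right)) := by
  ext w
  simp only [mem_univ_pi, mem_preimage, mem_prod, split]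
  refine ⟨fun h => ⟨h _, fun j => h _, fun j => h _⟩, fun ⟨h1, h2, h3⟩ j => ?_⟩
  rcases Node.eq_root_or j with rfl | ⟨i, rfl⟩ | ⟨i, rfl⟩
  · exact h1
  · exact h2 i
  · exact h3 i

/-- The event is independent of finitely many generations of division ratios. -/
theorem measure_eventOn_inter_pi (hT : IsIntervalProperty T) (f : C(UnitAddCircle, 𝕜)) (n : ℕ) :
    ∀ t : Node → Set ℝ, (∀ j, MeasurableSet (t j)) → (∀ j, n < j.1.1 → t j = univ) →
      ∀ x y : I, x < y →
        nodeLaw (eventOn T f x y ∩ univ.pi t) = nodeLaw (eventOn T f x y) * nodeLaw (univ.pi t) := by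
  induction n with
  -- Levels start at `1`, so here the box imposes no condition.
  | zero =>
    intro t _ ht' x y _
    have : univ.pi t = univ := by
      ext w
      simp [fun j => ht' j j.level_pos]
    rw [this, inter_univ, measure_univ, mul_one]
  | succ n ih =>
    intro t ht ht' x y hxy
    have hl : ∀ j : Node, n < j.1.1 → t j.left = univ := fun j hj =>
      ht' _ (Nat.succ_lt_succ hj)
    have hr : ∀ j : Node, n < j.1.1 → t j.right = univ := fun j hj =>
      ht' _ (Nat.succ_lt_succ hj)
    have m1 : MeasurableSet (univ.pi fun j : Node => t j.left) := MeasurableSet.univ_pi fun j => ht _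
    have m2 : MeasurableSet (univ.pi fun j : Node => t j.right) :=
      MeasurableSet.univ_pi fun j => ht _
    rw [univ_pi_eq_split_preimage t, measure_eventOn_inter hT f hxy (ht _) m1 m2,
      nodeLaw_split_preimage (ht _) m1 m2]
    have key : ∀ᵐ u ∂(unif.restrict (t Node.root)),
        nodeLaw (eventOn T f x (divPoint x y u) ∩ univ.pi fun j : Node => t j.left) *
          nodeLaw (eventOn T f (divPoint x y u) y ∩ univ.pi fun j : Node => t j.right) =
        nodeLaw (eventOn T f x y) * (nodeLaw (univ.pi fun j : Node => t j.left) *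
          nodeLaw (univ.pi fun j : Node => t j.right)) := by
      refine ae_restrict_of_ae ?_
      -- The induction hypothesis is used on the two random intervals, and `hu` shows that the
      -- product of their probabilities does not depend on `u`.
      filter_upwards [ae_measure_eventOn_mul hT f hxy, ae_unif_mem_Ioo] with u hu hu'
      rw [ih _ (fun j => ht _) hl _ _ (left_lt_divPoint hxy hu'),
        ih _ (fun j => ht _) hr _ _ (divPoint_lt_right hxy hu'), ← hu]
      ring
    rw [lintegral_congr_ae key, lintegral_const, Measure.restrict_apply_univ]
    ring

/-- If the event has positive probability, conditioning on it leaves the law of every finite box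
unchanged, hence the whole law; but the conditioned law gives the event mass `1`. -/
theorem measure_eventOn_eq_zero_or_one (hT : IsIntervalProperty T) (f : C(UnitAddCircle, 𝕜))
    {x y : I} (hxy : x < y) :
    nodeLaw (eventOn T f x y) = 0 ∨ nodeLaw (eventOn T f x y) = 1 := by
  classical
  set A := eventOn T f x y with hA
  have hAm : MeasurableSet A := measurableSet_eventOn hT f x y
  by_cases h0 : nodeLaw A = 0
  · exact Or.inl h0
  have htop : nodeLaw A ≠ ⊤ := measure_ne_top _ _
  have key : (nodeLaw A)⁻¹ • nodeLaw.restrict A = nodeLaw := by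
    refine Measure.eq_infinitePi _ fun s t ht => ?_
    have hpi : MeasurableSet (Set.pi (s : Set Node) t) :=
      MeasurableSet.pi s.countable_toSet fun j _ => ht j
    rw [Measure.smul_apply, Measure.restrict_apply hpi, smul_eq_mul, inter_comm,
      ← univ_pi_ite (s := (s : Set Node)),
      -- A finite box restricts only the generations up to the largest level in `s`.
      measure_eventOn_inter_pi hT f (s.sup fun j => j.1.1) _ _ _ x y hxy, ← mul_assoc,
      ENNReal.inv_mul_cancel h0 htop, one_mul, univ_pi_ite]
    · exact Measure.infinitePi_pi _ fun j _ => ht j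
    · intro j
      split_ifs
      exacts [ht j, MeasurableSet.univ]
    · intro j hj
      have : j ∉ (s : Set Node) := fun h =>
        absurd (Finset.le_sup (f := fun j : Node => j.1.1) (Finset.mem_coe.1 h)) (not_le.2 hj)
      rw [if_neg this]
  right
  conv_lhs => rw [← key]
  rw [Measure.smul_apply, Measure.restrict_apply_self, smul_eq_mul, ENNReal.inv_mul_cancel h0 htop]

end SelfSimilarity

/-! ### The zero-one law on the original probability space -/

section ZeroOneLaw

variable {𝕜 : Type*} [RCLike 𝕜] {Ω : Type*} [MeasurableSpace Ω] {P : Measure Ω}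
  [IsProbabilityMeasure P] {X : ℕ → ℕ → Ω → ℝ} {T : C(UnitAddCircle, 𝕜) → I → I → Fin 2}

/-- The extension is unique, so for almost every `ω` the existential in `propertyEvent` can only
refer to `homeo`. The measurable preimage then gives measurability for the completed measure. -/
theorem propertyEvent_ae_eq (hX : IsUniformFamily P X) (f : C(UnitAddCircle, 𝕜)) :
    (propertyEvent X T f : Set Ω) =ᵐ[P]
      (fun ω (j : Node) => X j.1.1 j.1.2 ω) ⁻¹' eventOn T f 0 1 := by
  filter_upwards [(map_eq_nodeLaw hX).quasiMeasurePreserving.ae ae_mem_goodRatios] with ω hω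
  set w : Node → ℝ := fun j => X j.1.1 j.1.2 ω with hw
  have hext : Extends (fun n k => X n k ω) (homeo w) :=
    (extends_homeo hω).congr fun n k h h' => nodeFun_of_mem _ h h'
  refine propext ⟨?_, fun h => ?_⟩
  · rintro ⟨φ, hφ, h⟩
    refine ⟨zero_le_one, ?_⟩
    change T (localComp f (homeo w) 0 1) 0 1 = 1
    rwa [localComp_zero_one, hext.unique hφ]
  · refine ⟨homeo w, hext, ?_⟩
    rw [← localComp_zero_one]
    exact h.2

theorem zero_one_law (hX : IsUniformFamily P X) (hT : IsIntervalProperty T)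
    (f : C(UnitAddCircle, 𝕜)) :
    NullMeasurableSet (propertyEvent X T f) P ∧
      (P (propertyEvent X T f) = 0 ∨ P (propertyEvent X T f) = 1) := by
  have hm := map_eq_nodeLaw hX
  have hA := measurableSet_eventOn hT f 0 1
  have hae := propertyEvent_ae_eq (T := T) hX f
  refine ⟨(hm.measurable hA).nullMeasurableSet.congr hae.symm, ?_⟩
  rw [measure_congr hae, hm.measure_preimage hA.nullMeasurableSet]
  exact measure_eventOn_eq_zero_or_one hT f zero_lt_one

end ZeroOneLaw

end RandomHomeo

theorem mainTheorem3 {𝕜 : Type*} [RCLike 𝕜] {Ω : Type*} [MeasurableSpace Ω]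
    (P : Measure Ω) [IsProbabilityMeasure P] (X : ℕ → ℕ → Ω → ℝ)
    (hX : RandomHomeo.IsUniformFamily P X) :
    (∀ᵐ ω ∂P, ∃ φ : I ≃o I, RandomHomeo.Extends (fun n k => X n k ω) φ) ∧
    (∀ T : C(UnitAddCircle, 𝕜) → I → I → Fin 2, RandomHomeo.IsIntervalProperty T →
      ∀ f : C(UnitAddCircle, 𝕜),
        NullMeasurableSet (RandomHomeo.propertyEvent X T f) P ∧
        (P (RandomHomeo.propertyEvent X T f) = 0 ∨ P (RandomHomeo.propertyEvent X T f) = 1)) ∧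
    (∀ p : ℝ → ℝ → ℝ,
      AEMeasurable (fun q : ℝ × ℝ => p q.1 q.2) (volume.restrict RandomHomeo.triangle) →
      (∀ x y : ℝ, 0 ≤ x → x ≤ y → y ≤ 1 → 0 ≤ p x y ∧ p x y ≤ 1) →
      (∀ x y : ℝ, 0 ≤ x → x < y → y ≤ 1 →
        p x y = 1 / (y - x) * ∫ t in x..y, p x t * p t y) →
      ∀ᵐ q : ℝ × ℝ × ℝ, 0 ≤ q.1 → q.1 < q.2.1 → q.2.1 < q.2.2 → q.2.2 ≤ 1 →
        p q.1 q.2.2 ≤ p q.1 q.2.1 ∧ p q.1 q.2.2 ≤ p q.2.1 q.2.2 ∧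
        p q.1 q.2.2 = p q.1 q.2.1 * p q.2.1 q.2.2) :=
  ⟨RandomHomeo.ae_exists_extends hX, fun _ hT f => RandomHomeo.zero_one_law hX hT f,
    fun _ hm hp heq => RandomHomeo.ae_eq_mul_of_eq_integral hm hp heq⟩
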